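/- Let $p\neq l$ be primes, let $E$ be a finite extension of $\mathbb{Q}_p$ and let $F/E$ be a totally ramified Galois extension of degree $l$, with $\sigma$ a generator of $\mathrm{Gal}(F/E)$. Let $k$ be the common residue field of $E$ and $F$, and let $n\ge 1$. Let $\alpha$ be an irreducible cuspidal representation of $\mathrm{GL}_n(k)$ on a finite-dimensional $\overline{\mathbb{Q}}_l$-vector space $V$, and let $\omega:F^\times\to\overline{\mathbb{Z}}_l^\times$ be a character whose restriction to $\mathcal{O}_F^\times$ is the inflation of the central character of $\alpha$. Assume that the level zero, minimal-maximal type representation $$\rho=\operatorname{c-Ind}_{F^\times \mathrm{GL}_n(\mathcal{O}_F)}^{\mathrm{GL}_n(F)}\omega\alpha$$ is $\mathrm{Gal}(F/E)$-equivariant, that is, $\rho\cong\rho\circ\gamma$ for all $\gamma\in\mathrm{Gal}(F/E)$ (for example, $\rho$ may be the base change $\mathrm{bc}(\pi)$ of an irreducible cuspidal $l$-adic representation $\pi$ of $\mathrm{GL}_n(E)$ of level zero and minimal-maximal type, when $n$ is prime to $pl$). Let $L\subset V$ be a $\mathrm{GL}_n(k)$-stable $\overline{\mathbb{Z}}_l$-lattice.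 The discrete set $X=F^\times\mathrm{GL}_n(\mathcal{O}_F)\backslash\mathrm{GL}_n(F)$ is the vertex set of the Bruhat-Tits building of $\mathrm{GL}_n(F)$, and $\sigma$ acts on it through the entries of matrices. Let $\mathcal{F}$ be the sheaf on $X$ whose compactly supported sections over $U\subset X$ are the functions $f:\mathrm{GL}_n(F)\to L$ supported on finitely many cosets, all of them in $U$, such that $f(zkg)=\omega(z)\alpha(\bar k)f(g)$ for all $z\in F^\times$, $k\in\mathrm{GL}_n(\mathcal{O}_F)$ with reduction $\bar k\in \mathrm{GL}_n(k)$, and $g\in\mathrm{GL}_n(F)$. Let $\lambda:\mathcal{F}(U)\to\mathcal{F}(\sigma^{-1}U)$ be given by $(\lambda f)(g)=f(\sigma(g))$, let $N=1+\lambda+\dots+\lambda^{l-1}$, and let $T^0(\mathcal{F})=\ker(1-\lambda)/\operatorname{Im}N$ be the Tate cohomology sheaf on the fixed-point set $X^\sigma$. Then $T^0(\mathcal{F})$ is supported on the vertex set of the building of $\mathrm{GL}_n(E)$, i.e. on the image of the canonical map $E^\times\mathrm{GL}_n(\mathcal{O}_E)\backslash\mathrm{GL}_n(E)\to X$: the stalk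 of $T^0(\mathcal{F})$ at every vertex $w\in X^\sigma$ that is not in this image is $0$. -/

import Mathlib

open Matrix

universe u

noncomputable section

namespace TateBuilding

/-! ### Local fields and their rings of integers -/

/-- The ring of integers of an algebraic extension `K` of `ℚ_[p]`: the closed unit ball of the
unique extension to `K` of the `p`-adic absolute value. For `K` a finite extension this is the ring
of integers of the local field `K`; for `K = PadicAlgCl p` it is the integral closure of the
`p`-adic integers. -/
def integers (p : ℕ) [Fact p.Prime] (K : Type*) [Field K] [Algebra ℚ_[p] K]
    [Algebra.IsAlgebraic ℚ_[p] K] : ValuationSubring K where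
  carrier := {x | spectralNorm ℚ_[p] K x ≤ 1}
  mul_mem' {a b} ha hb := by
    have h := map_mul (spectralMulAlgNorm ℚ_[p] K) a b
    simp only [spectralMulAlgNorm_def] at h
    simp only [Set.mem_ofPred_eq] at ha hb ⊢
    rw [h]
    exact mul_le_one₀ ha (spectralNorm_nonneg b) hb
  one_mem' := by simp [spectralNorm_one]
  add_mem' {a b} ha hb :=
    (isNonarchimedean_spectralNorm (K := ℚ_[p]) (L := K) a b).trans (max_le ha hb)
  zero_mem' := by simp [spectralNorm_zero]
  neg_mem' {a} ha := by
    simp only [Set.mem_ofPred_eq] at ha ⊢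
    rwa [spectralNorm_neg (Algebra.IsAlgebraic.isAlgebraic a)]
  mem_or_inv_mem' a := by
    simp only [Set.mem_ofPred_eq]
    have h := map_inv₀ (spectralMulAlgNorm ℚ_[p] K) a
    simp only [spectralMulAlgNorm_def] at h
    rw [h]
    rcases le_total (spectralNorm ℚ_[p] K a) 1 with h1 | h1
    · exact Or.inl h1
    · exact Or.inr (inv_le_one_of_one_le₀ h1)

lemma mem_integers {p : ℕ} [Fact p.Prime] {K : Type*} [Field K] [Algebra ℚ_[p] K]
    [Algebra.IsAlgebraic ℚ_[p] K] {x : K} :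
    x ∈ integers p K ↔ spectralNorm ℚ_[p] K x ≤ 1 := Iff.rfl

/-- The residue field of `K`. -/
abbrev Residue (p : ℕ) [Fact p.Prime] (K : Type*) [Field K] [Algebra ℚ_[p] K]
    [Algebra.IsAlgebraic ℚ_[p] K] : Type _ := IsLocalRing.ResidueField (integers p K)

/-- A homomorphism of algebraic extensions of `ℚ_[p]` restricts to the rings of integers. -/
def integersMap (p : ℕ) [Fact p.Prime] {K L : Type*} [Field K] [Algebra ℚ_[p] K]
    [Algebra.IsAlgebraic ℚ_[p] K] [Field L] [Algebra ℚ_[p] L] [Algebra.IsAlgebraic ℚ_[p] L]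
    (φ : K →ₐ[ℚ_[p]] L) : integers p K →+* integers p L :=
  (φ : K →+* L).restrict (integers p K) (integers p L) fun x hx => by
    rw [mem_integers] at hx ⊢
    have h : minpoly ℚ_[p] (φ x) = minpoly ℚ_[p] x := minpoly.algHom_eq φ φ.injective x
    simpa [spectralNorm, h] using hx

/-- `F / E` is totally ramified: the residue field of `E` is the whole residue field of `F`. -/
def IsTotallyRamified (p : ℕ) [Fact p.Prime] (E F : Type*) [Field E] [Algebra ℚ_[p] E]
    [Algebra.IsAlgebraic ℚ_[p] E] [Field F] [Algebra ℚ_[p] F] [Algebra.IsAlgebraic ℚ_[p] F]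
    [Algebra E F] [IsScalarTower ℚ_[p] E F] : Prop :=
  Function.Surjective ((IsLocalRing.residue (integers p F)).comp
    (integersMap p (IsScalarTower.toAlgHom ℚ_[p] E F)))

/-! ### Vertices of the building of `GL_n` -/

section Vertices

variable (p : ℕ) [Fact p.Prime] (n : ℕ)
variable (K : Type*) [Field K] [Algebra ℚ_[p] K] [Algebra.IsAlgebraic ℚ_[p] K]

/-- The inclusion of `GL_n` of the ring of integers of `K` into `GL_n(K)`. -/
def integralGL : GL (Fin n) (integers p K) →* GL (Fin n) K :=
  GeneralLinearGroup.map (integers p K).subtype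

/-- Reduction from `GL_n` of the ring of integers of `K` to `GL_n` of the residue field. -/
def reduceGL : GL (Fin n) (integers p K) →* GL (Fin n) (Residue p K) :=
  GeneralLinearGroup.map (IsLocalRing.residue (integers p K))

/-- The subgroup `Kˣ · GL_n(𝒪_K)` of `GL_n(K)`. -/
def maxCompactModCenter : Subgroup (GL (Fin n) K) :=
  (GeneralLinearGroup.scalar (Fin n) : Kˣ →* GL (Fin n) K).range ⊔ (integralGL p n K).range

/-- The vertex set of the Bruhat-Tits building of `GL_n(K)`: the space of right cosets
`(Kˣ GL_n(𝒪_K)) \ GL_n(K)`. The coset of `g` is the homothety class of the `𝒪_K`-lattice spanned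
by the rows of `g`. -/
def Vertex : Type _ := Quotient (QuotientGroup.rightRel (maxCompactModCenter p n K))

variable {K}

/-- The vertex given by the coset of `g`. -/
def vertexMk (g : GL (Fin n) K) : Vertex p n K := Quotient.mk _ g

variable {L : Type*} [Field L] [Algebra ℚ_[p] L] [Algebra.IsAlgebraic ℚ_[p] L]

lemma map_maxCompactModCenter_le (φ : K →ₐ[ℚ_[p]] L) :
    (maxCompactModCenter p n K).map (GeneralLinearGroup.map (φ : K →+* L)) ≤
      maxCompactModCenter p n L := by
  rw [maxCompactModCenter, Subgroup.map_sup]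
  refine sup_le_sup ?_ ?_
  · rintro _ ⟨_, ⟨z, rfl⟩, rfl⟩
    refine ⟨Units.map (φ : K →* L) z, ?_⟩
    ext i j
    by_cases h : i = j <;> simp [h, GeneralLinearGroup.map, GeneralLinearGroup.scalar]
  · rintro _ ⟨_, ⟨k, rfl⟩, rfl⟩
    exact ⟨GeneralLinearGroup.map (integersMap p φ) k, by ext i j; rfl⟩

/-- The map on vertices induced by a field homomorphism, applied to the entries of matrices. -/
def vertexMap (φ : K →ₐ[ℚ_[p]] L) : Vertex p n K → Vertex p n L :=
  Quotient.map' (GeneralLinearGroup.map (φ : K →+* L)) fun a b h => by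
    rw [QuotientGroup.rightRel_apply] at h ⊢
    rw [← map_inv, ← map_mul]
    exact map_maxCompactModCenter_le p n φ (Subgroup.mem_map_of_mem _ h)

end Vertices

/-- The canonical embedding of the vertices of the building of `GL_n(E)` into those of the building
of `GL_n(F)`: its image consists of the homothety classes of lattices having a basis in `E ^ n`. -/
def vertexEmbedding (p : ℕ) [Fact p.Prime] (n : ℕ) (E F : Type*) [Field E] [Algebra ℚ_[p] E]
    [Algebra.IsAlgebraic ℚ_[p] E] [Field F] [Algebra ℚ_[p] F] [Algebra.IsAlgebraic ℚ_[p] F]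
    [Algebra E F] [IsScalarTower ℚ_[p] E F] : Vertex p n E → Vertex p n F :=
  vertexMap p n (IsScalarTower.toAlgHom ℚ_[p] E F)

/-! ### Cuspidal representations of `GL_n` of a (finite) field -/

/-- The maximal standard parabolic subgroup `P_m`: the matrices whose lower-left `(n - m) × m` block
vanishes. -/
def parabolic (k : Type*) [Field k] (n m : ℕ) : Subgroup (GL (Fin n) k) where
  carrier := {g | (g : Matrix (Fin n) (Fin n) k).BlockTriangular fun i => decide (m ≤ (i : ℕ))}
  mul_mem' ha hb := by
    simp only [Set.mem_ofPred_eq, Units.val_mul] at *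
    exact ha.mul hb
  one_mem' := by
    simp only [Set.mem_ofPred_eq, Units.val_one]
    exact blockTriangular_one
  inv_mem' {g} hg := by
    simp only [Set.mem_ofPred_eq, coe_units_inv] at *
    have : Invertible (g : Matrix (Fin n) (Fin n) k) := g.invertible
    exact blockTriangular_inv_of_blockTriangular hg

lemma mem_parabolic {k : Type*} [Field k] {n m : ℕ} {g : GL (Fin n) k} :
    g ∈ parabolic k n m ↔ ∀ i j : Fin n, m ≤ (i : ℕ) → (j : ℕ) < m → g i j = 0 := by
  change Matrix.BlockTriangular _ _ ↔ _
  refine ⟨fun h i j hi hj => h (by simp [hi, Bool.lt_iff, hj]), fun h i j hij => ?_⟩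
  have : m ≤ (i : ℕ) ∧ (j : ℕ) < m := by
    rw [Bool.lt_iff] at hij
    simpa [and_comm] using hij
  exact h i j this.1 this.2

/-- `g` lies in the unipotent radical `U_m` of `P_m`: it coincides with the identity matrix outside
of the upper-right `m × (n - m)` block. -/
def InUnipotentRadical {k : Type*} [Field k] {n : ℕ} (m : ℕ) (g : GL (Fin n) k) : Prop :=
  ∀ i j : Fin n, ¬((i : ℕ) < m ∧ m ≤ (j : ℕ)) → g i j = (1 : Matrix (Fin n) (Fin n) k) i j

/-- `α` is cuspidal: for `1 ≤ m ≤ n - 1` and every representation `τ` of `P_m / U_m` (that is, of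
`P_m` trivial on `U_m`), there is no nonzero homomorphism from `α` to the representation of
`GL_n(k)` induced from `τ`. -/
def IsCuspidal {C k : Type*} [Field C] [Field k] {n : ℕ} {V : Type u} [AddCommGroup V] [Module C V]
    (α : Representation C (GL (Fin n) k) V) : Prop :=
  ∀ m : ℕ, 1 ≤ m → m < n →
    ∀ (W : Type u) [AddCommGroup W] [Module C W] (τ : Representation C (parabolic k n m) W),
      (∀ g : parabolic k n m, InUnipotentRadical m (g : GL (Fin n) k) → τ g = 1) →
        ∀ T : α.IntertwiningMap (Representation.coind (parabolic k n m).subtype τ), T = 0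

/-! ### Level zero representations and the associated sheaf -/

section Sheaf

variable {p : ℕ} [Fact p.Prime] {l : ℕ} [Fact l.Prime] {n : ℕ}
variable {F : Type*} [Field F] [Algebra ℚ_[p] F] [Algebra.IsAlgebraic ℚ_[p] F]
variable {V : Type*} [AddCommGroup V] [Module (PadicAlgCl l) V]

/-- The character `ω` of `Fˣ` extends (the inflation to the units of `𝒪_F` of) the central character
of `α`. -/
def ExtendsCentralCharacter
    (α : Representation (PadicAlgCl l) (GL (Fin n) (Residue p F)) V)
    (ω : Fˣ →* (integers l (PadicAlgCl l))ˣ) : Prop :=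
  ∀ (u : (integers p F)ˣ) (v : V),
    α (reduceGL p n F (GeneralLinearGroup.scalar (Fin n) u)) v =
      ((ω (Units.map (integers p F).subtype.toMonoidHom u) :
        integers l (PadicAlgCl l)) : PadicAlgCl l) • v

/-- The space of the compactly induced representation of `ωα` from `Fˣ GL_n(𝒪_F)` to `GL_n(F)`:
functions `f` with `f (z k g) = ω(z) α(k) f(g)` whose support is a finite union of cosets of
`Fˣ GL_n(𝒪_F)`. -/
def compactInduction (α : Representation (PadicAlgCl l) (GL (Fin n) (Residue p F)) V)
    (ω : Fˣ →* (integers l (PadicAlgCl l))ˣ) : Submodule (PadicAlgCl l) (GL (Fin n) F → V) where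
  carrier := {f |
    (∀ (z : Fˣ) (k : GL (Fin n) (integers p F)) (g : GL (Fin n) F),
      f (GeneralLinearGroup.scalar (Fin n) z * integralGL p n F k * g) =
        ((ω z : integers l (PadicAlgCl l)) : PadicAlgCl l) • α (reduceGL p n F k) (f g)) ∧
    ∃ S : Set (Vertex p n F), S.Finite ∧ ∀ g, vertexMk p n g ∉ S → f g = 0}
  add_mem' := by
    rintro a b ⟨ha, S, hS, haS⟩ ⟨hb, S', hS', hbS⟩
    refine ⟨fun z k g => by simp [ha, hb], S ∪ S', hS.union hS', fun g hg => ?_⟩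
    simp only [Set.mem_union, not_or] at hg
    simp [haS g hg.1, hbS g hg.2]
  zero_mem' := ⟨fun z k g => by simp, ∅, Set.finite_empty, fun g _ => rfl⟩
  smul_mem' := by
    rintro c a ⟨ha, S, hS, haS⟩
    refine ⟨fun z k g => by simp [ha, smul_comm c], S, hS, fun g hg => by simp [haS g hg]⟩

/-- Right translation of a vertex by an element of the group. -/
def vertexTranslate (x : GL (Fin n) F) : Vertex p n F → Vertex p n F :=
  Quotient.map' (· * x) fun a b h => by
    rw [QuotientGroup.rightRel_apply] at h ⊢
    simpa [mul_assoc] using h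

/-- The level zero representation of `GL_n(F)` attached to `α` and `ω`: the compact induction of
`ωα`, with `GL_n(F)` acting by right translation of functions. -/
def levelZeroRep (α : Representation (PadicAlgCl l) (GL (Fin n) (Residue p F)) V)
    (ω : Fˣ →* (integers l (PadicAlgCl l))ˣ) :
    Representation (PadicAlgCl l) (GL (Fin n) F) (compactInduction α ω) where
  toFun x := (LinearMap.funLeft (PadicAlgCl l) V (· * x)).restrict fun f hf => by
    obtain ⟨hf, S, hS, hfS⟩ := hf
    refine ⟨fun z k g => ?_, vertexTranslate x⁻¹ '' S, hS.image _, fun g hg => ?_⟩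
    · simpa [LinearMap.funLeft, mul_assoc] using hf z k (g * x)
    · refine hfS (g * x) fun h => hg ⟨_, h, ?_⟩
      simp only [vertexTranslate, vertexMk, Quotient.map'_mk, mul_inv_cancel_right]
      rfl
  map_one' := by ext; simp [LinearMap.funLeft]
  map_mul' _ _ := by ext; simp [LinearMap.funLeft, mul_assoc]

/-- A representation `ρ` of `GL_n(F)` is `Gal(F/E)`-equivariant: `ρ ≅ ρ ∘ γ` for all `γ` in
`Gal(F/E)`, acting on the entries of matrices. -/
def IsGaloisEquivariant (E : Type*) [Field E] [Algebra E F] {C W : Type*} [Field C]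
    [AddCommGroup W] [Module C W] (ρ : Representation C (GL (Fin n) F) W) : Prop :=
  ∀ γ : F ≃ₐ[E] F,
    Nonempty (ρ.Equiv (ρ.comp (GeneralLinearGroup.map ((γ : F ≃+* F) : F →+* F))))

/-- `L` is a `GL_n`-stable lattice over the integral closure of the `l`-adic integers in the
`l`-adic representation `α`. -/
structure IsStableLattice {G : Type*} [Monoid G] (α : Representation (PadicAlgCl l) G V)
    (L : Submodule (integers l (PadicAlgCl l)) V) : Prop where
  fg : L.FG
  span_eq_top : Submodule.span (PadicAlgCl l) (L : Set V) = ⊤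
  stable : ∀ g, ∀ v ∈ L, α g v ∈ L

/-- The compactly supported sections over `U` of the sheaf on the (discrete) set of vertices of the
building of `GL_n(F)` attached to `ωα` and to the lattice `L` on which `α` acts: the functions
`f : GL_n(F) → L` in the compact induction that are supported on the cosets in `U`. -/
def compactSections (α : Representation (PadicAlgCl l) (GL (Fin n) (Residue p F)) V)
    (ω : Fˣ →* (integers l (PadicAlgCl l))ˣ) (L : Submodule (integers l (PadicAlgCl l)) V)
    (U : Set (Vertex p n F)) :
    Submodule (integers l (PadicAlgCl l)) (GL (Fin n) F → V) where
  carrier := {f | f ∈ compactInduction α ω ∧ (∀ g, f g ∈ L) ∧ ∀ g, vertexMk p n g ∉ U → f g = 0}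
  add_mem' := by
    rintro a b ⟨ha, haL, haU⟩ ⟨hb, hbL, hbU⟩
    exact ⟨add_mem ha hb, fun g => add_mem (haL g) (hbL g),
      fun g hg => by simp [haU g hg, hbU g hg]⟩
  zero_mem' := ⟨zero_mem _, fun g => zero_mem _, fun g _ => rfl⟩
  smul_mem' := by
    rintro c a ⟨ha, haL, haU⟩
    exact ⟨(compactInduction α ω).smul_mem (c : PadicAlgCl l) ha,
      fun g => L.smul_mem c (haL g), fun g hg => by simp [haU g hg]⟩

/-- The operator `(λ f)(g) = f(σ g)`. It maps sections over `U` to sections over `σ⁻¹ U`. -/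
def twist (l : ℕ) [Fact l.Prime] (n : ℕ) {F : Type*} [Field F] (V : Type*) [AddCommGroup V]
    [Module (PadicAlgCl l) V] (σ : F →+* F) :
    (GL (Fin n) F → V) →ₗ[integers l (PadicAlgCl l)] (GL (Fin n) F → V) :=
  LinearMap.funLeft _ V (GeneralLinearGroup.map σ)

/-- The `λ`-invariant sections over `U`. -/
def invariantSections (α : Representation (PadicAlgCl l) (GL (Fin n) (Residue p F)) V)
    (ω : Fˣ →* (integers l (PadicAlgCl l))ˣ) (L : Submodule (integers l (PadicAlgCl l)) V)
    (σ : F →+* F) (U : Set (Vertex p n F)) :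
    Submodule (integers l (PadicAlgCl l)) (GL (Fin n) F → V) :=
  compactSections α ω L U ⊓ LinearMap.ker (1 - twist l n V σ)

/-- The image of the norm `1 + λ + ⋯ + λ^(l-1)` on the sections over `U`. -/
def normSections (α : Representation (PadicAlgCl l) (GL (Fin n) (Residue p F)) V)
    (ω : Fˣ →* (integers l (PadicAlgCl l))ˣ) (L : Submodule (integers l (PadicAlgCl l)) V)
    (σ : F →+* F) (U : Set (Vertex p n F)) :
    Submodule (integers l (PadicAlgCl l)) (GL (Fin n) F → V) :=
  (compactSections α ω L U).map (∑ i ∈ Finset.range l, twist l n V σ ^ i)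

/-- The compactly supported sections of the Tate cohomology sheaf `T⁰ = ker (1 - λ) / im N` over a
set `U` of `σ`-fixed vertices. -/
abbrev TateZero (α : Representation (PadicAlgCl l) (GL (Fin n) (Residue p F)) V)
    (ω : Fˣ →* (integers l (PadicAlgCl l))ˣ) (L : Submodule (integers l (PadicAlgCl l)) V)
    (σ : F →+* F) (U : Set (Vertex p n F)) : Type _ :=
  invariantSections α ω L σ U ⧸ (normSections α ω L σ U).submoduleOf (invariantSections α ω L σ U)

end Sheaf

/-- The set of `σ`-fixed vertices at which the stalk of the Tate cohomology sheaf `T⁰` is nonzero.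
The space of vertices being discrete, this is the support of the sheaf `T⁰`, and its stalk at `w` is
its module of sections over `{w}`. -/
def tateSupport {p : ℕ} [Fact p.Prime] {l : ℕ} [Fact l.Prime] {n : ℕ} {F V : Type*} [Field F]
    [Algebra ℚ_[p] F] [Algebra.IsAlgebraic ℚ_[p] F] [AddCommGroup V] [Module (PadicAlgCl l) V]
    (α : Representation (PadicAlgCl l) (GL (Fin n) (Residue p F)) V)
    (ω : Fˣ →* (integers l (PadicAlgCl l))ˣ) (L : Submodule (integers l (PadicAlgCl l)) V)
    (σ : F →ₐ[ℚ_[p]] F) : Set (Vertex p n F) :=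
  {w | vertexMap p n σ w = w ∧ Nontrivial (TateZero α ω L (σ : F →+* F) {w})}

end TateBuilding

end

/-! Let `g` represent a `σ`-fixed vertex. Comparing determinants gives `σ(g) = k g` with `k` in
`GL_n(𝒪_F)`. Since `F/E` is totally ramified, `σ` acts trivially on the residue field, so the
reduction `s` of the cocycle value `k` satisfies `s ^ l = 1`. The argument splits according to
whether `s` is scalar.

If `s` is a scalar `c`, choose a uniformizer `ϖ` with `σ(ϖ) = u ϖ`. Tameness (`l ≠ p`) makes the
residue of `u` a primitive `l`-th root of unity, so replacing `g` by `ϖ ^ i g` for a suitable `i`,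
which does not move the vertex, reduces to `s = 1`. The average `∑ σ^i(g)` is then `K g` with `K`
congruent to `l` modulo the maximal ideal, hence `K` is invertible; its entries are fixed by `σ`,
and the vertex comes from `E`. This is `HasFixedResidues.vertexMk_mem_range_of_reduceGL_scalar`.

If `s` is not scalar, the stalk vanishes. Evaluation at `g` turns it into the question whether every
`s`-fixed vector `v` of `L` is a norm `∑ α(s^i) v'` with `v'` in `L`. As `s` is diagonalizable over
the residue field, one of its eigenspaces is proper and nonzero; let `U` be the unipotent radical of
the stabilizer of that eigenspace attached to the complementary sum of eigenspaces. Conjugation by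
`s` fixes only `1` in `U`, so `U \ {1}` splits into orbits of length `l`. Cuspidality gives `∑_{u ∈
U} α(u) v = 0`, that is `v = -∑_{u ≠ 1} α(u) v`, and grouping the right side by orbits exhibits it
as a norm. This is `IsCuspidal.exists_sum_pow_eq`, which `subsingleton_tateZero` transports to
sections. -/

namespace TateBuilding

/-! ### The spectral norm, the residue field and uniformizers. -/

section Arithmetic

variable {p : ℕ} [Fact p.Prime] {F : Type*} [Field F] [Algebra ℚ_[p] F]

lemma spectralNorm_map_mul [Algebra.IsAlgebraic ℚ_[p] F] (x y : F) :
    spectralNorm ℚ_[p] F (x * y) = spectralNorm ℚ_[p] F x * spectralNorm ℚ_[p] F y := by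
  simpa only [spectralMulAlgNorm_def] using map_mul (spectralMulAlgNorm ℚ_[p] F) x y

lemma spectralNorm_map_pow [Algebra.IsAlgebraic ℚ_[p] F] (x : F) (i : ℕ) :
    spectralNorm ℚ_[p] F (x ^ i) = spectralNorm ℚ_[p] F x ^ i := by
  simpa only [spectralMulAlgNorm_def] using map_pow (spectralMulAlgNorm ℚ_[p] F) x i

lemma spectralNorm_map_inv [Algebra.IsAlgebraic ℚ_[p] F] (x : F) :
    spectralNorm ℚ_[p] F x⁻¹ = (spectralNorm ℚ_[p] F x)⁻¹ := by
  simpa only [spectralMulAlgNorm_def] using map_inv₀ (spectralMulAlgNorm ℚ_[p] F) x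

lemma spectralNorm_map_div [Algebra.IsAlgebraic ℚ_[p] F] (x y : F) :
    spectralNorm ℚ_[p] F (x / y) = spectralNorm ℚ_[p] F x / spectralNorm ℚ_[p] F y := by
  rw [div_eq_mul_inv, spectralNorm_map_mul, spectralNorm_map_inv, div_eq_mul_inv]

lemma spectralNorm_pos [Algebra.IsAlgebraic ℚ_[p] F] {x : F} (hx : x ≠ 0) :
    0 < spectralNorm ℚ_[p] F x :=
  spectralNorm_zero_lt hx (Algebra.IsAlgebraic.isAlgebraic x)

lemma spectralNorm_algHom {K : Type*} [Field K] [Algebra ℚ_[p] K] (φ : F →ₐ[ℚ_[p]] K) (x : F) :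
    spectralNorm ℚ_[p] K (φ x) = spectralNorm ℚ_[p] F x := by
  rw [spectralNorm, spectralNorm, minpoly.algHom_eq φ φ.injective]

lemma isUnit_integers_iff [Algebra.IsAlgebraic ℚ_[p] F] {x : integers p F} :
    IsUnit x ↔ spectralNorm ℚ_[p] F x = 1 := by
  constructor
  · intro hx
    obtain ⟨y, hy⟩ := hx.exists_right_inv
    have h : (x : F) * y = 1 := congrArg Subtype.val hy
    have h1 := congrArg (spectralNorm ℚ_[p] F) h
    rw [spectralNorm_map_mul, spectralNorm_one] at h1
    refine le_antisymm (mem_integers.1 x.2) ?_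
    rw [← h1]
    exact mul_le_of_le_one_right (spectralNorm_nonneg _) (mem_integers.1 y.2)
  · intro h
    have h0 : (x : F) ≠ 0 := by
      intro h0
      rw [h0, spectralNorm_zero] at h
      exact zero_ne_one h
    refine IsUnit.of_mul_eq_one ⟨(x : F)⁻¹, ?_⟩ (Subtype.ext (mul_inv_cancel₀ h0))
    rw [mem_integers, spectralNorm_map_inv, h, inv_one]

lemma residue_eq_zero_iff [Algebra.IsAlgebraic ℚ_[p] F] {x : integers p F} :
    IsLocalRing.residue (integers p F) x = 0 ↔ spectralNorm ℚ_[p] F x < 1 := by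
  rw [IsLocalRing.residue_eq_zero_iff, IsLocalRing.mem_maximalIdeal, mem_nonunits_iff,
    isUnit_integers_iff, (mem_integers.1 x.2).lt_iff_ne]

lemma residue_eq_iff [Algebra.IsAlgebraic ℚ_[p] F] {x y : integers p F} :
    IsLocalRing.residue (integers p F) x = IsLocalRing.residue (integers p F) y ↔
      spectralNorm ℚ_[p] F (x - y : F) < 1 := by
  rw [← sub_eq_zero, ← map_sub, residue_eq_zero_iff]
  rfl

section Compactness

variable (p F)
variable [FiniteDimensional ℚ_[p] F]

/-- Both halves are local compactness of `F`. Finitely many open balls of radius `1` cover the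
closed unit ball. The open unit ball is also closed in an ultrametric space, hence compact, so the
norm attains its maximum there; the maximum is not `0` because `p` lies in that ball. -/
lemma exists_finite_integers_approx_and_uniformizer :
    (∃ t : Set F, t.Finite ∧ ∀ x : F, spectralNorm ℚ_[p] F x ≤ 1 →
      ∃ y ∈ t, spectralNorm ℚ_[p] F y ≤ 1 ∧ spectralNorm ℚ_[p] F (x - y) < 1) ∧
    ∃ ϖ : F, ϖ ≠ 0 ∧ spectralNorm ℚ_[p] F ϖ < 1 ∧
      ∀ x : F, spectralNorm ℚ_[p] F x < 1 → spectralNorm ℚ_[p] F x ≤ spectralNorm ℚ_[p] F ϖ := by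
  let : NormedField F := spectralNorm.normedField ℚ_[p] F
  let : NormedAlgebra ℚ_[p] F := spectralNorm.normedAlgebra ℚ_[p] F
  have hn : ∀ x : F, ‖x‖ = spectralNorm ℚ_[p] F x := fun _ => rfl
  have : ProperSpace F := FiniteDimensional.proper ℚ_[p] F
  have : IsUltrametricDist F := IsUltrametricDist.isUltrametricDist_of_isNonarchimedean_norm
    isNonarchimedean_spectralNorm
  simp only [← hn]
  constructor
  · obtain ⟨t, ht, htf, hcov⟩ := (isCompact_closedBall (0 : F) 1).finite_cover_balls one_pos
    refine ⟨t, htf, fun x hx => ?_⟩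
    obtain ⟨y, hy, hxy⟩ := Set.mem_iUnion₂.1 (hcov (mem_closedBall_zero_iff.2 hx))
    exact ⟨y, hy, mem_closedBall_zero_iff.1 (ht hy), by rwa [mem_ball_iff_norm] at hxy⟩
  · have hc : IsCompact (Metric.ball (0 : F) 1) :=
      Metric.isCompact_of_isClosed_isBounded (IsUltrametricDist.isClosed_ball 0 1)
        Metric.isBounded_ball
    obtain ⟨ϖ, hϖ, hmax⟩ := hc.exists_isMaxOn ⟨0, by simp⟩ continuous_norm.continuousOn
    have hmax' : ∀ x : F, ‖x‖ < 1 → ‖x‖ ≤ ‖ϖ‖ := fun x hx => hmax (mem_ball_zero_iff.2 hx)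
    refine ⟨ϖ, ?_, mem_ball_zero_iff.1 hϖ, hmax'⟩
    rintro rfl
    have h1 : ‖algebraMap ℚ_[p] F p‖ = ‖(p : ℚ_[p])‖ := spectralNorm_extends _
    have h2 := hmax' (algebraMap ℚ_[p] F p) (h1 ▸ Padic.norm_p_lt_one)
    rw [h1, norm_zero, norm_le_zero_iff] at h2
    exact (Fact.out : p.Prime).ne_zero (by exact_mod_cast h2)

lemma finite_residue : Finite (Residue p F) := by
  obtain ⟨⟨t, ht, hcov⟩, -⟩ := exists_finite_integers_approx_and_uniformizer p F
  have hfin : Finite ((↑) ⁻¹' t : Set (integers p F)) :=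
    (ht.preimage Subtype.val_injective.injOn).to_subtype
  refine Finite.of_surjective (fun y : ((↑) ⁻¹' t : Set (integers p F)) =>
    IsLocalRing.residue (integers p F) y) fun x => ?_
  obtain ⟨x, rfl⟩ := IsLocalRing.residue_surjective x
  obtain ⟨y, hy, hy1, hxy⟩ := hcov x (mem_integers.1 x.2)
  have hres := residue_eq_iff (x := x) (y := ⟨y, mem_integers.2 hy1⟩)
  exact ⟨⟨⟨y, mem_integers.2 hy1⟩, hy⟩, (hres.2 hxy).symm⟩

end Compactness

lemma spectralNorm_natCast_prime_ne [Algebra.IsAlgebraic ℚ_[p] F] {l : ℕ} (hl : l.Prime)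
    (hpl : p ≠ l) : spectralNorm ℚ_[p] F (l : F) = 1 := by
  have h : (l : F) = algebraMap ℚ_[p] F (l : ℚ_[p]) := by simp
  rw [h, spectralNorm_extends, Padic.norm_natCast_eq_one_iff]
  exact (Nat.coprime_primes Fact.out hl).2 hpl

end Arithmetic

/-! ### Orbits of prime length. -/

section FreeAction

/-- Since `l` is prime, a point that is not fixed has exact period `l`; the induction removes one
full orbit at a time. `R` collects one point per orbit, which is what turns a sum over `Y` into a
norm. -/
lemma exists_orbit_representatives {X : Type*} [DecidableEq X] {l : ℕ} (hl : l.Prime)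
    (φ : X → X) (Y : Finset X) (hmap : ∀ y ∈ Y, φ y ∈ Y) (hper : ∀ y ∈ Y, φ^[l] y = y)
    (hfix : ∀ y ∈ Y, φ y ≠ y) :
    ∃ R ⊆ Y, ∀ {M : Type*} [AddCommMonoid M] (f : X → M),
      ∑ y ∈ Y, f y = ∑ i ∈ Finset.range l, ∑ r ∈ R, f (φ^[i] r) := by
  induction Y using Finset.strongInduction with
  | H Y ih =>
    rcases Y.eq_empty_or_nonempty with rfl | ⟨y, hy⟩
    · exact ⟨∅, subset_rfl, fun f => by simp⟩
    have hmin : Function.minimalPeriod φ y = l :=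
      (hl.eq_one_or_self_of_dvd _ (Function.IsPeriodicPt.minimalPeriod_dvd (hper y hy))).resolve_left
        fun h => hfix y hy (Function.minimalPeriod_eq_one_iff_isFixedPt.1 h)
    have hinj : Set.InjOn (fun i => φ^[i] y) (Finset.range l) := by
      have := Function.iterate_injOn_Iio_minimalPeriod (f := φ) (x := y)
      rw [hmin] at this
      simpa [Finset.coe_range] using this
    have hit : ∀ i, φ^[i] y ∈ Y := fun i => by
      induction i with
      | zero => exact hy
      | succ i hi => rw [Function.iterate_succ_apply']; exact hmap _ hi
    set O : Finset X := (Finset.range l).image fun i => φ^[i] y with hO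
    have hOY : O ⊆ Y := by
      intro x hx
      obtain ⟨i, -, rfl⟩ := Finset.mem_image.1 hx
      exact hit i
    have hyO : y ∈ O := Finset.mem_image.2 ⟨0, by simp [hl.pos], rfl⟩
    have hOmem : ∀ i, φ^[i] y ∈ O := fun i => by
      rw [← Function.iterate_mod_minimalPeriod_eq, hmin]
      exact Finset.mem_image.2 ⟨_, by simp [Nat.mod_lt _ hl.pos], rfl⟩
    obtain ⟨R, hR, hsum⟩ := ih (Y \ O) (Finset.sdiff_ssubset hOY ⟨y, hyO⟩)
      (fun x hx => by
        rw [Finset.mem_sdiff] at hx ⊢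
        refine ⟨hmap x hx.1, fun h => hx.2 ?_⟩
        obtain ⟨i, -, hi⟩ := Finset.mem_image.1 h
        -- On `Y` the map `φ^[l - 1]` inverts `φ`, so a point sent into the orbit already belongs to
        -- it.
        have : x = φ^[l - 1 + i] y := by
          rw [Function.iterate_add_apply]
          change φ^[i] y = φ x at hi
          rw [hi, ← Function.iterate_succ_apply, Nat.succ_eq_add_one, Nat.sub_add_cancel hl.one_le,
            hper x hx.1]
        exact this ▸ hOmem _)
      (fun x hx => hper x (Finset.sdiff_subset hx)) (fun x hx => hfix x (Finset.sdiff_subset hx))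
    have hyR : y ∉ R := fun h => (Finset.mem_sdiff.1 (hR h)).2 hyO
    refine ⟨insert y R, ?_, fun f => ?_⟩
    · exact Finset.insert_subset hy (hR.trans Finset.sdiff_subset)
    · simp only [Finset.sum_insert hyR, Finset.sum_add_distrib]
      rw [← hsum, ← Finset.sum_sdiff hOY, add_comm, hO, Finset.sum_image hinj]

end FreeAction

/-! ### Parabolic subgroups and their unipotent radicals through idempotents. -/

section UnipotentRadical

variable {k : Type*} [Field k] {n : ℕ}

/-- The diagonal idempotent matrix onto the first `m` coordinates. -/
def blockIdempotent (k : Type*) [Field k] (n m : ℕ) : Matrix (Fin n) (Fin n) k :=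
  Matrix.diagonal fun i => if (i : ℕ) < m then 1 else 0

lemma blockIdempotent_mul_self (m : ℕ) :
    blockIdempotent k n m * blockIdempotent k n m = blockIdempotent k n m := by
  simp [blockIdempotent, Matrix.diagonal_mul_diagonal]

/-- Stability of the range of the idempotent, written as a matrix identity so that later
computations need no indices. -/
lemma mem_parabolic_iff_blockIdempotent {m : ℕ} {g : GL (Fin n) k} :
    g ∈ parabolic k n m ↔
      (g : Matrix (Fin n) (Fin n) k) * blockIdempotent k n m =
        blockIdempotent k n m * g * blockIdempotent k n m := by
  rw [mem_parabolic]
  constructor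
  · intro h
    ext i j
    simp only [blockIdempotent, Matrix.mul_diagonal, Matrix.diagonal_mul]
    by_cases hi : (i : ℕ) < m
    · simp [hi]
    · by_cases hj : (j : ℕ) < m
      · simp [hi, hj, h i j (not_lt.1 hi) hj]
      · simp [hj]
  · intro h i j hi hj
    have := congrFun (congrFun h i) j
    simpa [blockIdempotent, Matrix.mul_diagonal, Matrix.diagonal_mul, hj, hi.not_gt] using this

/-- The two identities say that `g` acts trivially on the range of the idempotent and on the
quotient by it. -/
lemma inUnipotentRadical_iff {m : ℕ} {g : GL (Fin n) k} :
    InUnipotentRadical m g ↔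
      (g : Matrix (Fin n) (Fin n) k) * blockIdempotent k n m = blockIdempotent k n m ∧
        (1 - blockIdempotent k n m) * (g : Matrix (Fin n) (Fin n) k) =
          1 - blockIdempotent k n m := by
  have h1 : (1 - blockIdempotent k n m) =
      Matrix.diagonal fun i : Fin n => if (i : ℕ) < m then (0 : k) else 1 := by
    rw [blockIdempotent, ← Matrix.diagonal_one, Matrix.diagonal_sub]
    congr 1; ext i; split_ifs <;> simp
  rw [h1]
  simp only [← Matrix.ext_iff, blockIdempotent, Matrix.mul_diagonal, Matrix.diagonal_mul]
  constructor
  · intro h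
    refine ⟨fun i j => ?_, fun i j => ?_⟩
    · by_cases hj : (j : ℕ) < m
      · rw [h i j (by omega)]
        by_cases hij : i = j
        · subst hij; simp [hj]
        · simp [hij]
      · by_cases hij : i = j
        · subst hij; simp [hj]
        · simp [hj, hij]
    · by_cases hi : (i : ℕ) < m
      · by_cases hij : i = j
        · subst hij; simp [hi]
        · simp [hi, hij]
      · rw [h i j (by omega)]
        by_cases hij : i = j
        · subst hij; simp [hi]
        · simp [hij]
  · rintro ⟨ha, hb⟩ i j hij
    by_cases hj : (j : ℕ) < m
    · have := ha i j
      simp only [hj, if_true, mul_one] at this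
      rw [this]
      by_cases h : i = j
      · subst h; simp [hj]
      · simp [h]
    · have hi : ¬ (i : ℕ) < m := by omega
      have := hb i j
      simp only [hi, if_false, one_mul] at this
      rw [this]
      by_cases h : i = j
      · subst h; simp [hi]
      · simp [h]

/-- The unipotent radical `U_m` of `P_m`. -/
def unipotentRadical (k : Type*) [Field k] (n m : ℕ) : Subgroup (GL (Fin n) k) where
  carrier := {g | InUnipotentRadical m g}
  one_mem' := fun _ _ _ => rfl
  mul_mem' {a b} ha hb := by
    simp only [Set.mem_ofPred_eq, inUnipotentRadical_iff, Units.val_mul] at *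
    rw [mul_assoc, hb.1, ha.1, ← mul_assoc, ha.2, hb.2]
    exact ⟨rfl, rfl⟩
  inv_mem' {a} ha := by
    simp only [Set.mem_ofPred_eq, inUnipotentRadical_iff] at *
    constructor
    · nth_rw 1 [← ha.1]
      rw [← mul_assoc, Units.inv_mul, one_mul]
    · nth_rw 1 [← ha.2]
      rw [mul_assoc, Units.mul_inv, mul_one]

lemma conj_mem_unipotentRadical {m : ℕ} {g u : GL (Fin n) k} (hg : g ∈ parabolic k n m)
    (hu : u ∈ unipotentRadical k n m) : g * u * g⁻¹ ∈ unipotentRadical k n m := by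
  have hg' := inv_mem hg
  rw [mem_parabolic_iff_blockIdempotent] at hg hg'
  obtain ⟨h1, h2⟩ := inUnipotentRadical_iff.1 hu
  refine inUnipotentRadical_iff.2 ?_
  simp only [Units.val_mul]
  set e := blockIdempotent k n m
  -- Equivalent to `(1 - e) g e = 0`: the action of `g` descends to the quotient by the range of
  -- `e`.
  have hge : (1 - e) * (g : Matrix (Fin n) (Fin n) k) = (1 - e) * g * (1 - e) := by
    rw [mul_sub, mul_one, mul_assoc _ _ e, hg, ← mul_assoc, ← mul_assoc,
      sub_mul 1 e e, one_mul, blockIdempotent_mul_self, sub_self, zero_mul, zero_mul, sub_zero]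
  constructor
  · rw [mul_assoc, hg', mul_assoc, ← mul_assoc _ (e * _) e, ← mul_assoc _ e, h1, ← hg', ← mul_assoc,
      Units.mul_inv, one_mul]
  · rw [← mul_assoc, ← mul_assoc, hge, mul_assoc _ (1 - e) (u : Matrix (Fin n) (Fin n) k), h2,
      ← hge, mul_assoc, Units.mul_inv, mul_one]

end UnipotentRadical

/-! ### Cuspidality as vanishing of unipotent averages. -/

section Cuspidal

variable {C k : Type*} [Field C] [Field k] {n : ℕ} {V : Type u} [AddCommGroup V] [Module C V]
  {α : Representation C (GL (Fin n) k) V}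

/-- The quotient of `V` by the span `D` of the vectors `α u y - y` is the space of
`U_m`-coinvariants, a representation of `P_m` trivial on `U_m`. By Frobenius reciprocity the
projection onto it gives a map to an induced representation, which cuspidality kills. Hence `D` is
all of `V`, while the sum over `U_m` vanishes on `D`. -/
lemma IsCuspidal.sum_unipotentRadical_eq_zero (hα : IsCuspidal α) {m : ℕ} (h0 : 1 ≤ m) (hn : m < n)
    [Fintype (unipotentRadical k n m)] (v : V) :
    ∑ u : unipotentRadical k n m, α (u : GL (Fin n) k) v = 0 := by
  let D : Submodule C V := Submodule.span C
    {x | ∃ u ∈ unipotentRadical k n m, ∃ y, x = α u y - y}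
  have hD : ∀ g ∈ parabolic k n m, D ≤ D.comap (α g) := by
    intro g hg
    refine Submodule.span_le.2 ?_
    rintro _ ⟨u, hu, y, rfl⟩
    refine Submodule.subset_span ⟨_, conj_mem_unipotentRadical hg hu, α g y, ?_⟩
    simp [map_sub, ← Module.End.mul_apply, ← map_mul]
  let τ : Representation C (parabolic k n m) (V ⧸ D) :=
    { toFun := fun g => D.mapQ D (α g) (hD g g.2)
      map_one' := by ext; simp
      map_mul' := fun a b => by ext; simp }
  have hτ : ∀ g : parabolic k n m, InUnipotentRadical m (g : GL (Fin n) k) → τ g = 1 := by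
    intro g hg
    ext y
    exact (Submodule.Quotient.eq D).2 (Submodule.subset_span ⟨g, hg, y, rfl⟩)
  -- The Frobenius transform of the projection `V → V ⧸ D`; its value at `1` recovers the
  -- projection.
  let T₀ : V →ₗ[C] Representation.coindV (parabolic k n m).subtype τ :=
    { toFun := fun y => ⟨fun g => D.mkQ (α g y), fun g h => by simp [τ]⟩
      map_add' := fun a b => by ext; simp
      map_smul' := fun c a => by ext; simp }
  let T : α.IntertwiningMap (Representation.coind (parabolic k n m).subtype τ) :=
    { T₀ with
      isIntertwining' := fun g => by
        refine LinearMap.ext fun y => Subtype.ext (funext fun h => ?_)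
        change D.mkQ (α h (α g y)) = D.mkQ (α (h * g) y)
        rw [map_mul, Module.End.mul_apply] }
  have hT : T = 0 := hα m h0 hn (V ⧸ D) τ hτ T
  have hv : v ∈ D := by
    have h1 : (T v : _).1 1 = 0 := by rw [hT]; rfl
    have h2 : D.mkQ (α 1 v) = 0 := h1
    rwa [map_one, Module.End.one_apply, Submodule.mkQ_apply, Submodule.Quotient.mk_eq_zero] at h2
  let e : V →ₗ[C] V := ∑ u : unipotentRadical k n m, α (u : GL (Fin n) k)
  have he : D ≤ LinearMap.ker e := by
    refine Submodule.span_le.2 ?_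
    rintro _ ⟨u, hu, y, rfl⟩
    simp only [SetLike.mem_coe, LinearMap.mem_ker, map_sub, sub_eq_zero, e, LinearMap.sum_apply]
    rw [← Equiv.sum_comp (Equiv.mulRight (⟨u, hu⟩ : unipotentRadical k n m))
      fun w => α (w : GL (Fin n) k) y]
    simp
  simpa [e] using he hv

/-- If `s` normalises `U_m` and permutes its nontrivial elements with orbits of length `l`, the
vectors of a stable lattice fixed by `s` are norms. -/
lemma IsCuspidal.exists_sum_pow_eq_of_block (hα : IsCuspidal α) [Finite k] {l : ℕ} (hl : l.Prime)
    {m : ℕ} (h0 : 1 ≤ m) (hn : m < n) {s : GL (Fin n) k} (hs : s ^ l = 1)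
    (hsP : s ∈ parabolic k n m)
    (hfree : ∀ u ∈ unipotentRadical k n m, s * u * s⁻¹ = u → u = 1)
    (L : AddSubgroup V) (hL : ∀ g, ∀ v ∈ L, α g v ∈ L) {v : V} (hv : v ∈ L) (hsv : α s v = v) :
    ∃ v' ∈ L, ∑ i ∈ Finset.range l, α (s ^ i) v' = v := by
  classical
  have : Finite (GL (Fin n) k) := inferInstance
  let := Fintype.ofFinite (unipotentRadical k n m)
  let φ : unipotentRadical k n m → unipotentRadical k n m := fun u =>
    ⟨s * u * s⁻¹, conj_mem_unipotentRadical hsP u.2⟩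
  have hφ : ∀ i u, ((φ^[i] u : unipotentRadical k n m) : GL (Fin n) k) = s ^ i * u * (s ^ i)⁻¹ := by
    intro i u
    induction i with
    | zero => simp
    | succ i ih =>
      rw [Function.iterate_succ_apply', pow_succ']
      simp only [φ, ih]
      group
  obtain ⟨R, -, hR⟩ := exists_orbit_representatives hl φ (Finset.univ.erase 1)
    (fun u hu => by
      simp only [Finset.mem_erase, Finset.mem_univ, and_true] at hu ⊢
      intro h
      apply hu
      have : s * (u : GL (Fin n) k) * s⁻¹ = 1 := congrArg Subtype.val h
      exact Subtype.ext (by simpa using this))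
    (fun u _ => Subtype.ext (by rw [hφ, hs]; simp))
    (fun u hu h => by
      simp only [Finset.mem_erase, Finset.mem_univ, and_true] at hu
      exact hu (Subtype.ext (hfree u u.2 (congrArg Subtype.val h))))
  have hsv' : ∀ i : ℕ, α (s ^ i)⁻¹ v = v := fun i => by
    have h1 : α (s ^ i) v = v := by
      induction i with
      | zero => simp
      | succ i ih => rw [pow_succ, map_mul, Module.End.mul_apply, hsv, ih]
    nth_rw 1 [← h1]
    rw [← Module.End.mul_apply, ← map_mul, inv_mul_cancel, map_one, Module.End.one_apply]
  have hsum := hα.sum_unipotentRadical_eq_zero h0 hn v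
  rw [← Finset.add_sum_erase _ _ (Finset.mem_univ 1),
    hR (fun u => α (u : GL (Fin n) k) v)] at hsum
  -- The term `u = 1` of the vanishing sum is `v`, so `v` is minus the sum over `u ≠ 1`; only one
  -- representative per orbit is kept.
  refine ⟨-∑ r ∈ R, α (r : GL (Fin n) k) v,
    neg_mem (sum_mem fun r _ => hL _ _ hv), ?_⟩
  -- Because `s ^ i` fixes `v`, it carries `α(r) v` to `α(s ^ i r s ^ (-i)) v`.
  have : ∀ i, α (s ^ i) (-∑ r ∈ R, α (r : GL (Fin n) k) v) =
      -∑ r ∈ R, α (φ^[i] r : unipotentRadical k n m) v := fun i => by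
    rw [map_neg, map_sum]
    congr 1
    refine Finset.sum_congr rfl fun r _ => ?_
    rw [hφ, map_mul, map_mul, Module.End.mul_apply, hsv', Module.End.mul_apply]
  simp only [this, Finset.sum_neg_distrib]
  rw [neg_eq_iff_add_eq_zero, add_comm]
  simpa using hsum

end Cuspidal

/-! ### Idempotents and eigenprojections. -/

section LinearAlgebra

variable {k : Type*} [Field k] {n : ℕ}

/-- The columns of `h` form a basis adapted to the splitting of the space into range and kernel of
`P`, range first; `m` is the rank. -/
lemma exists_conj_blockIdempotent (P : Matrix (Fin n) (Fin n) k) (hP : P * P = P) :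
    ∃ (h : GL (Fin n) k) (m : ℕ), m ≤ n ∧
      P * (h : Matrix (Fin n) (Fin n) k) = h * blockIdempotent k n m := by
  let f := Matrix.toLin' P
  have hf : IsIdempotentElem f := by
    rw [IsIdempotentElem, Module.End.mul_eq_comp, ← Matrix.toLin'_mul, hP]
  have hc : IsCompl (LinearMap.range f) (LinearMap.ker f) := LinearMap.IsIdempotentElem.isCompl hf
  let b₁ := Module.finBasis k (LinearMap.range f)
  let b₂ := Module.finBasis k (LinearMap.ker f)
  have hn : Module.finrank k (LinearMap.range f) + Module.finrank k (LinearMap.ker f) = n := by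
    rw [LinearMap.finrank_range_add_finrank_ker]; simp
  let b := ((b₁.prod b₂).map (Submodule.prodEquivOfIsCompl _ _ hc)).reindex
    (finSumFinEquiv.trans (finCongr hn))
  have hb : ∀ j, P *ᵥ (b j) = (if (j : ℕ) < Module.finrank k (LinearMap.range f) then (1 : k) else 0)
      • b j := by
    intro j
    obtain ⟨x, rfl⟩ := (finSumFinEquiv.trans (finCongr hn)).surjective j
    rw [← Matrix.toLin'_apply]
    change f _ = _
    rcases x with x | x
    · have hx : f (b₁ x : Fin n → k) = b₁ x := by
        obtain ⟨y, hy⟩ := (b₁ x).2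
        rw [← hy, ← Module.End.mul_apply, hf.eq]
      simp [b, hx]
    · simp [b]
  obtain ⟨h, hh⟩ : ∃ h : GL (Fin n) k, ∀ i j, (h : Matrix (Fin n) (Fin n) k) i j = b j i := by
    have := (Pi.basisFun k (Fin n)).invertibleToMatrix b
    exact ⟨unitOfInvertible ((Pi.basisFun k (Fin n)).toMatrix b), fun i j => rfl⟩
  refine ⟨h, Module.finrank k (LinearMap.range f), hn.le.trans' (Nat.le_add_right _ _), ?_⟩
  generalize Module.finrank k (LinearMap.range f) = m at hb
  clear_value b
  refine Matrix.ext fun i j => ?_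
  have hij := congrFun (hb j) i
  rw [Pi.smul_apply, smul_eq_mul, Matrix.mulVec, dotProduct] at hij
  rw [blockIdempotent, Matrix.mul_diagonal, Matrix.mul_apply, hh, mul_comm (b j i), ← hij]
  exact Finset.sum_congr rfl fun x _ => by rw [hh]

/-- The projection onto an eigenspace of an element of prime order `l` different from the
characteristic, in the presence of nontrivial `l`-th roots of unity. -/
lemma exists_eigenprojection {l : ℕ} (hl : l.Prime) (hlk : (l : k) ≠ 0) {ζ : k} (hζ : ζ ^ l = 1)
    (hζ1 : ζ ≠ 1) {s : Matrix (Fin n) (Fin n) k} (hs : s ^ l = 1)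
    (hns : ∀ c : k, c ^ l = 1 → s ≠ c • (1 : Matrix (Fin n) (Fin n) k)) :
    ∃ (c : k) (P R : Matrix (Fin n) (Fin n) k), P * P = P ∧ P ≠ 0 ∧ P ≠ 1 ∧
      s * P = c • P ∧ P * s = c • P ∧ (s - c • 1) * R = 1 - P := by
  have hprim : IsPrimitiveRoot ζ l := by
    have := Fact.mk hl
    rw [← orderOf_eq_prime hζ hζ1]
    exact IsPrimitiveRoot.orderOf ζ
  have : Nontrivial (Matrix (Fin n) (Fin n) k) := by
    by_contra h
    rw [not_nontrivial_iff_subsingleton] at h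
    exact hns 1 (one_pow l) (Subsingleton.elim _ _)
  -- With `Q = (X ^ l - 1) / (X - c)`, the projection is `Q(s) / Q(c)`. The matrix `R` is the value
  -- at `s` of the quotient of `1 - Q / Q(c)` by `X - c`; it records that `s - c` is invertible on
  -- the complement.
  open Polynomial in
  have key : ∀ c : k, c ^ l = 1 → ∃ P R : Matrix (Fin n) (Fin n) k, P * P = P ∧
      s * P = c • P ∧ P * s = c • P ∧ (s - c • 1) * R = 1 - P := by
    intro c hc
    have hc0 : c ≠ 0 := fun h => by rw [h, zero_pow hl.ne_zero] at hc; exact zero_ne_one hc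
    obtain ⟨Q, hQ⟩ : (X - C c) ∣ (X ^ l - 1 : k[X]) := dvd_iff_isRoot.2 (by simp [IsRoot, hc])
    -- Differentiating `X ^ l - 1 = (X - c) Q` at `c` gives `Q(c) = l c ^ (l - 1)`.
    have hQc : Q.eval c ≠ 0 := by
      have := congrArg (fun q => (derivative q).eval c) hQ
      simp only [derivative_sub, derivative_X_pow, derivative_one, sub_zero, derivative_mul,
        derivative_X, derivative_C, one_mul, eval_add, eval_mul, eval_sub, eval_X, eval_C,
        sub_self, zero_mul, add_zero, eval_pow] at this
      rw [← this]
      simp [hlk, hc0]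
    obtain ⟨R, hR⟩ : (X - C c) ∣ (1 - C (Q.eval c)⁻¹ * Q : k[X]) :=
      dvd_iff_isRoot.2 (by simp [IsRoot, hQc])
    have h1 : (s - c • 1) * aeval s (C (Q.eval c)⁻¹ * Q) = 0 := by
      have : aeval s ((X - C c) * (C (Q.eval c)⁻¹ * Q)) = 0 := by
        rw [mul_left_comm, ← hQ]
        simp [hs]
      simpa [Algebra.algebraMap_eq_smul_one] using this
    have h2 : (s - c • 1) * aeval s R = 1 - aeval s (C (Q.eval c)⁻¹ * Q) := by
      have := congrArg (aeval s) hR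
      rw [map_mul, map_sub, map_sub, aeval_X, aeval_C, map_one,
        Algebra.algebraMap_eq_smul_one] at this
      exact this.symm
    have hcomm : ∀ q : k[X], aeval s q * s = s * aeval s q := fun q => by
      have := congrArg (aeval s) (mul_comm q X)
      rwa [map_mul, map_mul, aeval_X] at this
    set P := aeval s (C (Q.eval c)⁻¹ * Q)
    have h3 : s * P = c • P := by
      rw [sub_mul, sub_eq_zero] at h1
      simpa using h1
    have h4 : P * s = c • P := (hcomm _).trans h3
    refine ⟨P, aeval s R, ?_, h3, h4, h2⟩
    have h5 : P * ((s - c • 1) * aeval s R) = 0 := by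
      rw [← mul_assoc, mul_sub, h4]; simp
    rw [h2, mul_sub, mul_one, sub_eq_zero] at h5
    exact h5.symm
  -- If every `s - c` were invertible, so would be their product `s ^ l - 1 = 0`.
  open Polynomial in
  obtain ⟨c, hc, hcs⟩ : ∃ c : k, c ^ l = 1 ∧ ¬ IsUnit (s - c • (1 : Matrix (Fin n) (Fin n) k)) := by
    by_contra! hcon
    have hunit : ∀ T : Finset k, (∀ c ∈ T, c ^ l = 1) → IsUnit (aeval s (∏ c ∈ T, (X - C c))) := by
      intro T hT
      induction T using Finset.cons_induction with
      | empty => simp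
      | cons a T ha ih =>
        rw [Finset.prod_cons, map_mul]
        refine IsUnit.mul ?_ (ih fun c hc => hT c (by simp [hc]))
        simpa [Algebra.algebraMap_eq_smul_one] using hcon a (hT a (by simp))
    have h0 := hunit (nthRootsFinset l 1) fun c hc => (mem_nthRootsFinset hl.pos 1).1 hc
    rw [← X_pow_sub_one_eq_prod hl.pos hprim] at h0
    simp [hs] at h0
  obtain ⟨P, R, hPP, h1, h2, h3⟩ := key c hc
  refine ⟨c, P, R, hPP, ?_, ?_, h1, h2, h3⟩
  · rintro rfl
    rw [sub_zero] at h3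
    exact hcs (IsUnit.of_mul_eq_one _ h3)
  · rintro rfl
    exact hns c hc (by simpa using h1)

end LinearAlgebra

/-! ### Fixed vectors of a non-scalar element are norms. -/

section NonScalar

variable {C k : Type*} [Field C] [Field k] [Finite k] {n : ℕ} {V : Type u} [AddCommGroup V]
  [Module C V] {α : Representation C (GL (Fin n) k) V}

/-- After conjugation the eigenprojection of `s` is a block idempotent with `1 ≤ m < n`, as it is
neither `0` nor `1`. Elements of `U_m` have the form `1 + a` with `a` mapping the complement to the
`c`-eigenspace; commuting with `s` forces `a = 0` since `c` is not an eigenvalue on the complement.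
The block case then applies. -/
theorem IsCuspidal.exists_sum_pow_eq (hα : IsCuspidal α) {l : ℕ} (hl : l.Prime)
    (hlk : (l : k) ≠ 0) {ζ : k} (hζ : ζ ^ l = 1) (hζ1 : ζ ≠ 1) {s : GL (Fin n) k} (hs : s ^ l = 1)
    (hns : ∀ c : k, c ^ l = 1 →
      (s : Matrix (Fin n) (Fin n) k) ≠ c • (1 : Matrix (Fin n) (Fin n) k))
    (L : AddSubgroup V) (hL : ∀ g, ∀ v ∈ L, α g v ∈ L) {v : V} (hv : v ∈ L) (hsv : α s v = v) :
    ∃ v' ∈ L, ∑ i ∈ Finset.range l, α (s ^ i) v' = v := by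
  obtain ⟨c, P, R, hPP, hP0, hP1, hsP, hPs, hR⟩ :=
    exists_eigenprojection hl hlk hζ hζ1 (s := (s : Matrix (Fin n) (Fin n) k))
      (by rw [← Units.val_pow_eq_pow_val, hs, Units.val_one]) hns
  obtain ⟨h, m, hmn, hm⟩ := exists_conj_blockIdempotent P hPP
  set e := blockIdempotent k n m with he
  have he' : ((h⁻¹ : GL (Fin n) k) : Matrix (Fin n) (Fin n) k) * P * h = e := by
    rw [mul_assoc, hm, ← mul_assoc, Units.inv_mul, one_mul]
  have hPe : P = h * e * ((h⁻¹ : GL (Fin n) k) : Matrix (Fin n) (Fin n) k) := by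
    rw [← hm, mul_assoc, Units.mul_inv, mul_one]
  have h0 : 1 ≤ m := by
    rw [Nat.one_le_iff_ne_zero]
    rintro rfl
    apply hP0
    have : e = 0 := by ext; simp [he, blockIdempotent]
    rw [hPe, this]; simp
  have hn : m < n := by
    refine hmn.lt_of_ne ?_
    rintro rfl
    apply hP1
    have : e = 1 := by rw [he, blockIdempotent, ← Matrix.diagonal_one]; simp
    rw [hPe, this]; simp
  have hse : ((h⁻¹ * s * h : GL (Fin n) k) : Matrix (Fin n) (Fin n) k) * e = c • e := by
    rw [← he']
    simp only [Units.val_mul]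
    calc _ = ((h⁻¹ : GL (Fin n) k) : Matrix (Fin n) (Fin n) k) * (s *
          ((h : Matrix (Fin n) (Fin n) k) * ((h⁻¹ : GL (Fin n) k) : Matrix (Fin n) (Fin n) k)) * P) *
            h := by simp only [mul_assoc]
      _ = _ := by rw [Units.mul_inv, mul_one, hsP]; simp
  have hsR : (((h⁻¹ * s * h : GL (Fin n) k) : Matrix (Fin n) (Fin n) k) - c • 1) *
      (((h⁻¹ : GL (Fin n) k) : Matrix (Fin n) (Fin n) k) * R * h) = 1 - e := by
    have h1 : ((h⁻¹ * s * h : GL (Fin n) k) : Matrix (Fin n) (Fin n) k) - c • 1 =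
        ((h⁻¹ : GL (Fin n) k) : Matrix (Fin n) (Fin n) k) * (s - c • 1) * h := by
      simp [mul_sub, sub_mul]
    calc _ = ((h⁻¹ : GL (Fin n) k) : Matrix (Fin n) (Fin n) k) * ((s - c • 1) *
          ((h : Matrix (Fin n) (Fin n) k) * ((h⁻¹ : GL (Fin n) k) : Matrix (Fin n) (Fin n) k)) * R) *
            h := by rw [h1]; simp only [mul_assoc]
      _ = _ := by
        rw [Units.mul_inv, mul_one, hR, mul_sub, sub_mul, he', mul_one, Units.inv_mul]
  set s' := h⁻¹ * s * h with hs'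
  have hpow : ∀ i : ℕ, s' ^ i = h⁻¹ * s ^ i * h := fun i => by
    simpa using (conj_pow (i := i) (a := h⁻¹) (b := s)).symm ▸ by simp
  obtain ⟨v', hv', hsum⟩ := hα.exists_sum_pow_eq_of_block hl h0 hn (s := s')
    (by rw [hpow, hs]; simp)
    (by
      rw [mem_parabolic_iff_blockIdempotent, mul_assoc, ← he, hse, mul_smul_comm,
        blockIdempotent_mul_self])
    -- Write `u = 1 + a`, so `e a = a` and `a e = 0`. Then `a s' = s' a = c a`, and multiplying `a
    -- (s' - c) = 0` by the conjugate of `R` gives `a (1 - e) = a = 0`.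
    (fun u hu huc => by
      rw [mul_inv_eq_iff_eq_mul] at huc
      obtain ⟨hu1, hu2⟩ := inUnipotentRadical_iff.1 hu
      rw [← he] at hu1 hu2
      have hc : (s' : Matrix (Fin n) (Fin n) k) * u = u * s' := congrArg Units.val huc
      set a := (u : Matrix (Fin n) (Fin n) k) - 1 with ha
      have ha1 : e * a = a := by
        have : (1 - e) * a = 0 := by rw [ha, mul_sub, hu2]; simp
        rw [sub_mul, one_mul, sub_eq_zero] at this
        exact this.symm
      have ha2 : a * e = 0 := by rw [ha, sub_mul, hu1]; simp
      have ha3 : (s' : Matrix (Fin n) (Fin n) k) * a = a * s' := by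
        rw [ha, mul_sub, sub_mul, hc]; simp
      have ha4 : a * ((s' : Matrix (Fin n) (Fin n) k) - c • 1) = 0 := by
        rw [mul_sub, ← ha3]
        nth_rw 1 [← ha1]
        rw [← mul_assoc, hse, smul_mul_assoc, ha1]
        simp
      have ha5 : a = 0 := by
        have := congrArg (a * ·) hsR
        simp only [← mul_assoc, ha4] at this
        rw [mul_sub, ha2] at this
        simpa using this.symm
      exact Units.ext (sub_eq_zero.1 ha5))
    -- The block case is applied to `α(h⁻¹) v`, which `s'` fixes; `α(h)` carries the result back.
    L hL (hL h⁻¹ v hv)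
    (by
      rw [← Module.End.mul_apply, ← map_mul, hs', mul_assoc, mul_inv_cancel, mul_one, map_mul,
        Module.End.mul_apply, hsv])
  refine ⟨α h v', hL _ _ hv', ?_⟩
  have := congrArg (α h) hsum
  rw [map_sum, ← Module.End.mul_apply, ← map_mul, mul_inv_cancel, map_one,
    Module.End.one_apply] at this
  rw [← this]
  refine Finset.sum_congr rfl fun i _ => ?_
  rw [hpow, ← Module.End.mul_apply, ← Module.End.mul_apply, ← map_mul, ← map_mul]
  congr 2
  group

end NonScalar

/-! ### Tamely ramified automorphisms. -/

section TameAction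

variable {p : ℕ} [Fact p.Prime] {F : Type*} [Field F] [Algebra ℚ_[p] F]
  [Algebra.IsAlgebraic ℚ_[p] F]

/-- Every integer of `F` is congruent to an integer fixed by `S`. -/
def HasFixedResidues (S : F →ₐ[ℚ_[p]] F) : Prop :=
  ∀ x : F, spectralNorm ℚ_[p] F x ≤ 1 →
    ∃ a : F, S a = a ∧ spectralNorm ℚ_[p] F (x - a) < 1

lemma coe_integersMap (S : F →ₐ[ℚ_[p]] F) (x : integers p F) : (integersMap p S x : F) = S x := rfl

lemma HasFixedResidues.residue_integersMap {S : F →ₐ[ℚ_[p]] F} (hS : HasFixedResidues S)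
    (x : integers p F) :
    IsLocalRing.residue (integers p F) (integersMap p S x) =
      IsLocalRing.residue (integers p F) x := by
  obtain ⟨a, ha, hxa⟩ := hS x (mem_integers.1 x.2)
  rw [residue_eq_iff, coe_integersMap]
  have h : S x - (x : F) = S (x - a) + -(x - a) := by rw [map_sub, ha]; ring
  rw [h]
  refine (isNonarchimedean_spectralNorm _ _).trans_lt (max_lt ?_ ?_)
  · rwa [spectralNorm_algHom]
  · rwa [spectralNorm_neg (Algebra.IsAlgebraic.isAlgebraic _)]

lemma natCast_residue_ne_zero {l : ℕ} (hl : l.Prime) (hpl : p ≠ l) :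
    (l : Residue p F) ≠ 0 := by
  have h : (l : Residue p F) = IsLocalRing.residue (integers p F) l := by simp
  rw [h, Ne, residue_eq_zero_iff]
  have h1 : ((l : integers p F) : F) = (l : F) := by simp
  rw [h1, spectralNorm_natCast_prime_ne hl hpl]
  exact lt_irrefl _

/-- A ramified automorphism fixes no uniformizer. -/
lemma HasFixedResidues.eq_self_of_uniformizer {S : F →ₐ[ℚ_[p]] F} (hS : HasFixedResidues S)
    {ϖ : F} (h0 : ϖ ≠ 0) (h1 : spectralNorm ℚ_[p] F ϖ < 1)
    (hmax : ∀ x : F, spectralNorm ℚ_[p] F x < 1 →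
      spectralNorm ℚ_[p] F x ≤ spectralNorm ℚ_[p] F ϖ)
    (hϖ : S ϖ = ϖ) (x : F) : S x = x := by
  -- Successive approximation: with `y = (x - a) / ϖ` integral, `S x - x = ϖ (S y - y)`, and each
  -- round gains a factor `ϖ`.
  have key : ∀ (m : ℕ) (x : F), spectralNorm ℚ_[p] F x ≤ 1 →
      spectralNorm ℚ_[p] F (S x - x) ≤ spectralNorm ℚ_[p] F ϖ ^ m := by
    intro m
    induction m with
    | zero =>
      intro x hx
      rw [pow_zero, sub_eq_add_neg]
      refine (isNonarchimedean_spectralNorm _ _).trans (max_le ?_ ?_)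
      · rwa [spectralNorm_algHom]
      · rwa [spectralNorm_neg (Algebra.IsAlgebraic.isAlgebraic _)]
    | succ m ih =>
      intro x hx
      obtain ⟨a, ha, hxa⟩ := hS x hx
      have hy : spectralNorm ℚ_[p] F ((x - a) / ϖ) ≤ 1 := by
        rw [spectralNorm_map_div]
        exact div_le_one_of_le₀ (hmax _ hxa) (spectralNorm_nonneg ϖ)
      have hx' : S x - x = ϖ * (S ((x - a) / ϖ) - (x - a) / ϖ) := by
        rw [map_div₀, map_sub, ha, hϖ]
        field_simp
        ring
      rw [hx', spectralNorm_map_mul, pow_succ']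
      exact mul_le_mul_of_nonneg_left (ih _ hy) (spectralNorm_nonneg ϖ)
  have hint : ∀ x : F, spectralNorm ℚ_[p] F x ≤ 1 → S x = x := by
    intro x hx
    by_contra hne
    obtain ⟨m, hm⟩ := exists_pow_lt_of_lt_one (spectralNorm_pos (p := p) (sub_ne_zero.2 hne)) h1
    exact (key m x hx).not_gt hm
  rcases le_total (spectralNorm ℚ_[p] F x) 1 with hx | hx
  · exact hint x hx
  · have := hint x⁻¹ (by rw [spectralNorm_map_inv]; exact inv_le_one_of_one_le₀ hx)
    rwa [map_inv₀, _root_.inv_inj] at this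

/-- As `S` is trivial on residues, `S^[i] ϖ = w ϖ` with `w` congruent to `u ^ i`, whence `u ^ l` has
residue `1`. Were `u` itself congruent to `1`, the trace `∑ S^[i] ϖ` would be `ϖ` times an element
congruent to `l`, hence a uniformizer because `l ≠ p`. It is fixed by `S`, which would make `S` the
identity. -/
lemma exists_uniformizer_map_eq_mul [FiniteDimensional ℚ_[p] F] {S : F →ₐ[ℚ_[p]] F} {l : ℕ}
    (hl : l.Prime) (hpl : p ≠ l) (hS : HasFixedResidues S) (hSl : ∀ x, S^[l] x = x)
    (hS1 : ∃ x, S x ≠ x) :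
    ∃ (ϖ : Fˣ) (u : (integers p F)ˣ), S ϖ = ((u : integers p F) : F) * ϖ ∧
      IsLocalRing.residue (integers p F) u ^ l = 1 ∧
      IsLocalRing.residue (integers p F) u ≠ 1 := by
  obtain ⟨-, ϖ, h0, h1, hmax⟩ := exists_finite_integers_approx_and_uniformizer p F
  have hnu : spectralNorm ℚ_[p] F (S ϖ / ϖ) = 1 := by
    rw [spectralNorm_map_div, spectralNorm_algHom, div_self (spectralNorm_pos h0).ne']
  let u₀ : integers p F := ⟨S ϖ / ϖ, mem_integers.2 hnu.le⟩
  have hu : IsUnit u₀ := isUnit_integers_iff.2 hnu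
  have hSϖ : S ϖ = (u₀ : F) * ϖ := (div_mul_cancel₀ _ h0).symm
  have hex : ∀ i : ℕ, ∃ w : integers p F, S^[i] ϖ = (w : F) * ϖ ∧
      IsLocalRing.residue (integers p F) w = IsLocalRing.residue (integers p F) u₀ ^ i := fun i => by
    induction i with
    | zero => exact ⟨1, (one_mul ϖ).symm, by rw [pow_zero, map_one]⟩
    | succ i ih =>
      obtain ⟨w, h2, h3⟩ := ih
      refine ⟨integersMap p S w * u₀, ?_, ?_⟩
      · rw [Function.iterate_succ_apply', h2, map_mul, hSϖ, ← mul_assoc]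
        rfl
      · rw [map_mul, hS.residue_integersMap, h3, pow_succ]
  choose v hv hvres using hex
  refine ⟨Units.mk0 ϖ h0, hu.unit, hSϖ, ?_, ?_⟩
  · have h2 : v l = 1 := by
      have h3 := hv l
      rw [hSl] at h3
      exact Subtype.ext (mul_right_cancel₀ h0 (h3.symm.trans (one_mul ϖ).symm))
    rw [IsUnit.unit_spec, ← hvres, h2, map_one]
  · intro hu1
    rw [IsUnit.unit_spec] at hu1
    obtain ⟨x, hx⟩ := hS1
    apply hx
    have hsum : ∑ i ∈ Finset.range l, S^[i] ϖ = ((∑ i ∈ Finset.range l, v i : integers p F) : F) * ϖ := by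
      simp only [hv, ← Finset.sum_mul]
      congr 1
      exact (map_sum (integers p F).subtype v (Finset.range l)).symm
    have hnorm : spectralNorm ℚ_[p] F ((∑ i ∈ Finset.range l, v i : integers p F) : F) = 1 := by
      rw [← isUnit_integers_iff]
      by_contra hcon
      have := (IsLocalRing.residue_eq_zero_iff _).2 ((IsLocalRing.mem_maximalIdeal _).2 hcon)
      rw [map_sum] at this
      simp only [hvres, hu1, one_pow, Finset.sum_const, Finset.card_range, nsmul_eq_mul,
        mul_one] at this
      exact natCast_residue_ne_zero hl hpl this
    have hn : spectralNorm ℚ_[p] F (∑ i ∈ Finset.range l, S^[i] ϖ) = spectralNorm ℚ_[p] F ϖ := by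
      rw [hsum, spectralNorm_map_mul, hnorm, one_mul]
    refine hS.eq_self_of_uniformizer (ϖ := ∑ i ∈ Finset.range l, S^[i] ϖ) ?_ (hn ▸ h1)
      (fun y hy => hn.symm ▸ hmax y hy) ?_ x
    · intro h
      rw [h, spectralNorm_zero] at hn
      exact (spectralNorm_pos h0).ne hn
    · rw [map_sum]
      simp only [← Function.iterate_succ_apply']
      -- Adding the missing term `ϖ = S^[l] ϖ` lets the sum over `l + 1` indices be split off at
      -- either end.
      rw [← add_left_inj ϖ]
      have h4 := Finset.sum_range_succ' (fun i => S^[i] ϖ) l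
      rw [Finset.sum_range_succ, hSl] at h4
      exact h4.symm

end TameAction

/-! ### The integral cocycle at a fixed vertex. -/

lemma iterate_map_apply {p : ℕ} [Fact p.Prime] {F : Type*} [Field F] [Algebra ℚ_[p] F] {n : ℕ}
    (S : F →ₐ[ℚ_[p]] F) (i : ℕ) (g : GL (Fin n) F) (a b : Fin n) :
    ((GeneralLinearGroup.map (S : F →+* F))^[i] g) a b = S^[i] (g a b) := by
  induction i with
  | zero => rfl
  | succ i ih =>
    rw [Function.iterate_succ_apply', Function.iterate_succ_apply', GeneralLinearGroup.map_apply,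
      ih]
    rfl

section VertexCocycle

variable {p : ℕ} [Fact p.Prime] {F : Type*} [Field F] [Algebra ℚ_[p] F]
  [Algebra.IsAlgebraic ℚ_[p] F] {n : ℕ}

lemma mem_maxCompactModCenter {g : GL (Fin n) F} :
    g ∈ maxCompactModCenter p n F ↔
      ∃ (z : Fˣ) (k : GL (Fin n) (integers p F)),
        g = GeneralLinearGroup.scalar (Fin n) z * integralGL p n F k := by
  have : (GeneralLinearGroup.scalar (Fin n) : Fˣ →* GL (Fin n) F).range.Normal := by
    refine ⟨?_⟩
    rintro _ ⟨z, rfl⟩ g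
    rw [← GeneralLinearGroup.scalar_commute, mul_inv_cancel_right]
    exact ⟨z, rfl⟩
  rw [maxCompactModCenter, Subgroup.mem_sup_of_normal_left]
  constructor
  · rintro ⟨_, ⟨z, rfl⟩, _, ⟨k, rfl⟩, rfl⟩
    exact ⟨z, k, rfl⟩
  · rintro ⟨z, k, rfl⟩
    exact ⟨_, ⟨z, rfl⟩, _, ⟨k, rfl⟩, rfl⟩

lemma vertexMk_eq_iff {g h : GL (Fin n) F} :
    vertexMk p n h = vertexMk p n g ↔ ∃ (z : Fˣ) (k : GL (Fin n) (integers p F)),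
      h = GeneralLinearGroup.scalar (Fin n) z * integralGL p n F k * g := by
  have h1 : vertexMk p n g = vertexMk p n h ↔ h * g⁻¹ ∈ maxCompactModCenter p n F :=
    Quotient.eq.trans QuotientGroup.rightRel_apply
  rw [eq_comm, h1, mem_maxCompactModCenter]
  simp only [mul_inv_eq_iff_eq_mul]

lemma integralGL_injective : Function.Injective (integralGL p n F) := by
  intro a b h
  ext i j
  exact congrArg (fun x : GL (Fin n) F => x i j) h

lemma map_integralGL (S : F →ₐ[ℚ_[p]] F) (k : GL (Fin n) (integers p F)) :
    GeneralLinearGroup.map (S : F →+* F) (integralGL p n F k) =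
      integralGL p n F (GeneralLinearGroup.map (integersMap p S) k) := rfl

lemma HasFixedResidues.reduceGL_map {S : F →ₐ[ℚ_[p]] F} (hS : HasFixedResidues S)
    (k : GL (Fin n) (integers p F)) :
    reduceGL p n F (GeneralLinearGroup.map (integersMap p S) k) = reduceGL p n F k := by
  ext i j
  exact hS.residue_integersMap (k i j)

/-- The cocycle values satisfy `k_(i+1) = S(k_i) k`; since `S` is trivial on residues, they reduce
to plain powers. -/
lemma HasFixedResidues.exists_iterate_map_eq {S : F →ₐ[ℚ_[p]] F} (hS : HasFixedResidues S)
    {g : GL (Fin n) F} {k : GL (Fin n) (integers p F)}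
    (hg : GeneralLinearGroup.map (S : F →+* F) g = integralGL p n F k * g) (i : ℕ) :
    ∃ k' : GL (Fin n) (integers p F),
      (GeneralLinearGroup.map (S : F →+* F))^[i] g = integralGL p n F k' * g ∧
        reduceGL p n F k' = reduceGL p n F k ^ i := by
  induction i with
  | zero => exact ⟨1, by simp, by simp⟩
  | succ i ih =>
    obtain ⟨k', h1, h2⟩ := ih
    refine ⟨GeneralLinearGroup.map (integersMap p S) k' * k, ?_, ?_⟩
    · rw [Function.iterate_succ_apply', h1, map_mul, hg, map_integralGL, map_mul, mul_assoc]
    · rw [map_mul, hS.reduceGL_map, h2, pow_succ]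

lemma HasFixedResidues.reduceGL_pow_eq_one {S : F →ₐ[ℚ_[p]] F} (hS : HasFixedResidues S) {l : ℕ}
    (hSl : ∀ x, S^[l] x = x) {g : GL (Fin n) F} {k : GL (Fin n) (integers p F)}
    (hg : GeneralLinearGroup.map (S : F →+* F) g = integralGL p n F k * g) :
    reduceGL p n F k ^ l = 1 := by
  obtain ⟨k', h1, h2⟩ := hS.exists_iterate_map_eq hg l
  have h3 : (GeneralLinearGroup.map (S : F →+* F))^[l] g = g := by
    ext a b
    rw [iterate_map_apply, hSl]
  rw [h3, right_eq_mul] at h1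
  rw [← h2, integralGL_injective (h1.trans (map_one _).symm), map_one]

/-- A fixed vertex only gives `S(g) = z k g`. As `S` preserves the norm of the determinant, `|z| ^ n
= 1`, so `z` is a unit and is absorbed into `k`. -/
lemma exists_map_eq_integralGL_mul (hn : n ≠ 0) {S : F →ₐ[ℚ_[p]] F} {g : GL (Fin n) F}
    (hw : vertexMap p n S (vertexMk p n g) = vertexMk p n g) :
    ∃ k : GL (Fin n) (integers p F),
      GeneralLinearGroup.map (S : F →+* F) g = integralGL p n F k * g := by
  obtain ⟨z, k, hg⟩ := vertexMk_eq_iff.1 hw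
  have hunit : ∀ x : (integers p F)ˣ, spectralNorm ℚ_[p] F ((x : integers p F) : F) = 1 :=
    fun x => isUnit_integers_iff.1 x.isUnit
  have hz : spectralNorm ℚ_[p] F z = 1 := by
    have hdet := congrArg (fun x : GL (Fin n) F =>
      spectralNorm ℚ_[p] F (GeneralLinearGroup.det x : Fˣ)) hg
    simp only [map_mul, GeneralLinearGroup.det_scalar, Units.val_mul, spectralNorm_map_mul] at hdet
    have h1 : ((GeneralLinearGroup.det (GeneralLinearGroup.map (S : F →+* F) g) : Fˣ) : F) =
        S (GeneralLinearGroup.det g : Fˣ) :=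
      ((S : F →+* F).map_det _).symm
    have h2 : ((GeneralLinearGroup.det (integralGL p n F k) : Fˣ) : F) =
        ((GeneralLinearGroup.det k : (integers p F)ˣ) : integers p F) :=
      ((integers p F).subtype.map_det _).symm
    rw [h1, h2, hunit, spectralNorm_algHom, mul_one, right_eq_mul₀
      (spectralNorm_pos (Units.ne_zero _)).ne', Units.val_pow_eq_pow_val, spectralNorm_map_pow,
      Fintype.card_fin, pow_eq_one_iff_of_nonneg (spectralNorm_nonneg _) hn] at hdet
    exact hdet
  have hzu : IsUnit (⟨z, mem_integers.2 hz.le⟩ : integers p F) := isUnit_integers_iff.2 hz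
  refine ⟨GeneralLinearGroup.scalar (Fin n) hzu.unit * k, ?_⟩
  rw [hg, map_mul]
  congr 2
  ext i j
  by_cases h : i = j <;> simp [h, integralGL, GeneralLinearGroup.scalar]

end VertexCocycle

/-! ### Descent to `E` when the cocycle has scalar reduction. -/

section Descent

variable {p : ℕ} [Fact p.Prime] {n : ℕ} {E F : Type*} [Field E] [Field F] [Algebra ℚ_[p] E]
  [Algebra ℚ_[p] F] [Algebra E F] [IsScalarTower ℚ_[p] E F] [Algebra.IsAlgebraic ℚ_[p] E]
  [Algebra.IsAlgebraic ℚ_[p] F]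

lemma vertexMk_mem_range_of_entries {g : GL (Fin n) F}
    (hg : ∀ i j, g i j ∈ Set.range (algebraMap E F)) :
    vertexMk p n g ∈ Set.range (vertexEmbedding p n E F) := by
  choose a ha using hg
  let A : Matrix (Fin n) (Fin n) E := Matrix.of a
  have hA : A.map (algebraMap E F) = g := by
    ext i j
    exact ha i j
  have hdet : A.det ≠ 0 := by
    intro h
    have h1 : ((GeneralLinearGroup.det g : Fˣ) : F) = algebraMap E F A.det := by
      rw [RingHom.map_det]
      exact congrArg Matrix.det hA.symm
    rw [h, map_zero] at h1
    exact Units.ne_zero _ h1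
  refine ⟨vertexMk p n (GeneralLinearGroup.mkOfDetNeZero A hdet), ?_⟩
  change vertexMk p n (GeneralLinearGroup.map _ _) = _
  congr 1
  ext i j
  exact ha i j

/-- Averaging trivializes the cocycle: `∑ S^[r] g = K g` where `K` reduces to `l`, a unit of the
residue field. So `K g` represents the same vertex, and its entries are traces, fixed by `S`. -/
lemma HasFixedResidues.vertexMk_mem_range_of_reduceGL_eq_one {S : F →ₐ[ℚ_[p]] F}
    (hS : HasFixedResidues S) {l : ℕ} (hl : l.Prime) (hpl : p ≠ l) (hSl : ∀ x, S^[l] x = x)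
    (hfix : ∀ x, S x = x → x ∈ Set.range (algebraMap E F))
    {g : GL (Fin n) F} {k : GL (Fin n) (integers p F)}
    (hg : GeneralLinearGroup.map (S : F →+* F) g = integralGL p n F k * g)
    (hk : reduceGL p n F k = 1) :
    vertexMk p n g ∈ Set.range (vertexEmbedding p n E F) := by
  choose κ hκ hκ' using hS.exists_iterate_map_eq hg
  let K : Matrix (Fin n) (Fin n) (integers p F) := ∑ i ∈ Finset.range l, (κ i).val
  have hKres : (IsLocalRing.residue (integers p F)).mapMatrix K =
      (l : Residue p F) • (1 : Matrix (Fin n) (Fin n) (Residue p F)) := by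
    have : ∀ i, (IsLocalRing.residue (integers p F)).mapMatrix (κ i).val = 1 := fun i =>
      congrArg Units.val (show reduceGL p n F (κ i) = 1 by rw [hκ', hk, one_pow])
    rw [map_sum, Finset.sum_congr rfl fun i _ => this i]
    simp [← Nat.cast_smul_eq_nsmul (Residue p F)]
  have hKdet : IsUnit K.det := by
    by_contra hcon
    have h1 := (IsLocalRing.residue_eq_zero_iff _).2 ((IsLocalRing.mem_maximalIdeal _).2 hcon)
    rw [RingHom.map_det, hKres, Matrix.det_smul, Matrix.det_one, mul_one] at h1
    exact natCast_residue_ne_zero hl hpl (eq_zero_of_pow_eq_zero h1)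
  let K' : GL (Fin n) (integers p F) := GeneralLinearGroup.mk'' K hKdet
  have hentry : ∀ i j, (integralGL p n F K' * g) i j = ∑ r ∈ Finset.range l, S^[r] (g i j) := by
    intro i j
    have h1 : ((integralGL p n F K' * g : GL (Fin n) F) : Matrix (Fin n) (Fin n) F) =
        ∑ r ∈ Finset.range l, ((GeneralLinearGroup.map (S : F →+* F))^[r] g).val := by
      have h2 : ((integralGL p n F K' : GL (Fin n) F) : Matrix (Fin n) (Fin n) F) =
          ∑ r ∈ Finset.range l, (integralGL p n F (κ r)).val :=
        map_sum (integers p F).subtype.mapMatrix (fun r => (κ r).val) (Finset.range l)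
      rw [Units.val_mul, h2, Finset.sum_mul]
      exact Finset.sum_congr rfl fun r _ => by rw [hκ, Units.val_mul]
    rw [h1, Matrix.sum_apply]
    exact Finset.sum_congr rfl fun r _ => iterate_map_apply S r g i j
  have hmem : vertexMk p n (integralGL p n F K' * g) ∈ Set.range (vertexEmbedding p n E F) := by
    refine vertexMk_mem_range_of_entries fun i j => hfix _ ?_
    rw [hentry, map_sum]
    simp only [← Function.iterate_succ_apply']
    rw [← add_left_inj (g i j)]
    have h4 := Finset.sum_range_succ' (fun r => S^[r] (g i j)) l
    rw [Finset.sum_range_succ, hSl] at h4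
    exact h4.symm
  rwa [vertexMk_eq_iff.2 ⟨1, K', by rw [map_one, one_mul]⟩] at hmem

/-- A vertex at which the cocycle of `S` has scalar reduction comes from the building of
`GL_n(E)`. -/
lemma HasFixedResidues.vertexMk_mem_range_of_reduceGL_scalar {S : F →ₐ[ℚ_[p]] F}
    (hS : HasFixedResidues S) {l : ℕ} (hl : l.Prime) (hpl : p ≠ l) (hSl : ∀ x, S^[l] x = x)
    (hfix : ∀ x, S x = x → x ∈ Set.range (algebraMap E F))
    {ϖ : Fˣ} {u : (integers p F)ˣ} (hϖ : S ϖ = ((u : integers p F) : F) * ϖ)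
    (hu : IsLocalRing.residue (integers p F) u ^ l = 1)
    (hu1 : IsLocalRing.residue (integers p F) u ≠ 1)
    {g : GL (Fin n) F} {k : GL (Fin n) (integers p F)}
    (hg : GeneralLinearGroup.map (S : F →+* F) g = integralGL p n F k * g)
    {c : Residue p F} (hc : c ^ l = 1)
    (hk : (reduceGL p n F k : Matrix (Fin n) (Fin n) (Residue p F)) = c • 1) :
    vertexMk p n g ∈ Set.range (vertexEmbedding p n E F) := by
  have hprim : IsPrimitiveRoot (IsLocalRing.residue (integers p F) (u : integers p F)) l := by
    have := Fact.mk hl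
    rw [← orderOf_eq_prime hu hu1]
    exact IsPrimitiveRoot.orderOf _
  have : NeZero l := ⟨hl.ne_zero⟩
  -- Multiplying `g` by `ϖ ^ i` multiplies the cocycle by `u ^ i`; the residue of `u` generates the
  -- `l`-th roots of unity, so some `i` cancels `c`.
  obtain ⟨i, -, hi⟩ := hprim.eq_pow_of_pow_eq_one (ξ := c⁻¹) (by rw [inv_pow, hc, inv_one])
  have hc0 : c ≠ 0 := fun h => by rw [h, zero_pow hl.ne_zero] at hc; exact zero_ne_one hc
  have hmem := hS.vertexMk_mem_range_of_reduceGL_eq_one (E := E) hl hpl hSl hfix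
    (g := GeneralLinearGroup.scalar (Fin n) (ϖ ^ i) * g)
    (k := GeneralLinearGroup.scalar (Fin n) (u ^ i) * k)
    (by
      have h1 : GeneralLinearGroup.map (S : F →+* F) (GeneralLinearGroup.scalar (Fin n) (ϖ ^ i)) =
          integralGL p n F (GeneralLinearGroup.scalar (Fin n) (u ^ i)) *
            GeneralLinearGroup.scalar (Fin n) (ϖ ^ i) := by
        rw [integralGL, GeneralLinearGroup.map_scalar, GeneralLinearGroup.map_scalar, ← map_mul]
        congr 1
        ext
        simp [hϖ, mul_pow]
      rw [map_mul, h1, hg, map_mul, mul_assoc, mul_assoc, ← mul_assoc _ (integralGL p n F k) g,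
        GeneralLinearGroup.scalar_commute, mul_assoc])
    (by
      rw [map_mul]
      refine Units.ext ?_
      rw [Units.val_mul, hk, reduceGL, GeneralLinearGroup.map_scalar]
      have h2 : (GeneralLinearGroup.scalar (Fin n) (Units.map
          (IsLocalRing.residue (integers p F) : integers p F →* Residue p F) (u ^ i))).val =
          c⁻¹ • (1 : Matrix (Fin n) (Fin n) (Residue p F)) := by
        rw [← hi, GeneralLinearGroup.coe_scalar, Matrix.scalar_apply, ← Matrix.smul_one_eq_diagonal]
        simp
      rw [h2]
      simp [hc0])
  rwa [(vertexMk_eq_iff (g := g)).2 ⟨ϖ ^ i, 1, by rw [map_one, mul_one]⟩] at hmem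

end Descent

/-! ### Sections supported at one vertex and the stalk of the Tate cohomology sheaf. -/

section Sections

variable {p : ℕ} [Fact p.Prime] {l : ℕ} [Fact l.Prime] {n : ℕ}
  {F : Type*} [Field F] [Algebra ℚ_[p] F] [Algebra.IsAlgebraic ℚ_[p] F]
  {V : Type*} [AddCommGroup V] [Module (PadicAlgCl l) V]
  {α : Representation (PadicAlgCl l) (GL (Fin n) (Residue p F)) V}
  {ω : Fˣ →* (integers l (PadicAlgCl l))ˣ}

/-- This makes `ωα` well defined on products `z k`. Two decompositions differ by a scalar matrix in
`GL_n(𝒪_F)`, whose entry is a unit because its `n`-th power is the determinant; on units `ω` agrees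
with the central character. -/
lemma reduceGL_smul_eq_of_mul_eq (hn : n ≠ 0) (hω : ExtendsCentralCharacter α ω) {z z' : Fˣ}
    {k k' : GL (Fin n) (integers p F)}
    (h : GeneralLinearGroup.scalar (Fin n) z * integralGL p n F k =
      GeneralLinearGroup.scalar (Fin n) z' * integralGL p n F k') (v : V) :
    ((ω z : integers l (PadicAlgCl l)) : PadicAlgCl l) • α (reduceGL p n F k) v =
      ((ω z' : integers l (PadicAlgCl l)) : PadicAlgCl l) • α (reduceGL p n F k') v := by
  have h1 : GeneralLinearGroup.scalar (Fin n) (z'⁻¹ * z) = integralGL p n F (k' * k⁻¹) := by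
    rw [map_mul, map_inv, map_mul, map_inv, inv_mul_eq_iff_eq_mul, eq_mul_inv_iff_mul_eq.2 h,
      mul_assoc]
  let i₀ : Fin n := ⟨0, Nat.pos_of_ne_zero hn⟩
  have hent : ∀ i j, (if i = j then ((z'⁻¹ * z : Fˣ) : F) else 0) =
      ((k' * k⁻¹ : GL (Fin n) (integers p F)) i j : F) := fun i j => by
    have h2 : (GeneralLinearGroup.scalar (Fin n) (z'⁻¹ * z)) i j =
      ((k' * k⁻¹ : GL (Fin n) (integers p F)) i j : F) := by rw [h1]; rfl
    rw [← h2, GeneralLinearGroup.coe_scalar, Matrix.scalar_apply, Matrix.diagonal_apply]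
  have hunit : IsUnit ((k' * k⁻¹ : GL (Fin n) (integers p F)) i₀ i₀) := by
    have hdet : IsUnit (k' * k⁻¹ : GL (Fin n) (integers p F)).val.det :=
      (GeneralLinearGroup.det (k' * k⁻¹)).isUnit
    have h3 : (k' * k⁻¹ : GL (Fin n) (integers p F)).val =
        Matrix.diagonal fun _ => (k' * k⁻¹ : GL (Fin n) (integers p F)) i₀ i₀ := by
      ext i j
      rw [← hent i j, Matrix.diagonal_apply]
      by_cases hij : i = j
      · simp only [hij, if_true, ← hent i₀ i₀]
      · simp [hij]
    rw [h3, Matrix.det_diagonal, Finset.prod_const] at hdet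
    exact (isUnit_pow_iff (by simpa using hn)).1 hdet
  let w : (integers p F)ˣ := hunit.unit
  have hw : Units.map (integers p F).subtype.toMonoidHom w = z'⁻¹ * z := by
    ext
    have := hent i₀ i₀
    rw [if_pos rfl] at this
    exact this.symm
  have hk : k' = GeneralLinearGroup.scalar (Fin n) w * k := by
    rw [← mul_inv_eq_iff_eq_mul]
    refine integralGL_injective ?_
    rw [← h1, ← hw, integralGL, GeneralLinearGroup.map_scalar]
    rfl
  have hωz : ((ω z : integers l (PadicAlgCl l)) : PadicAlgCl l) =
      ((ω z' : integers l (PadicAlgCl l)) : PadicAlgCl l) *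
        ((ω (z'⁻¹ * z) : integers l (PadicAlgCl l)) : PadicAlgCl l) := by
    nth_rw 1 [← mul_inv_cancel_left z' z]
    rw [map_mul]
    rfl
  rw [hk, map_mul, map_mul, Module.End.mul_apply, hω, hw, smul_smul, hωz]

/-- A vector of a stable lattice is the value at `g` of a section supported at the vertex of `g`. -/
lemma exists_compactSections_singleton (hn : n ≠ 0) (hω : ExtendsCentralCharacter α ω)
    {L : Submodule (integers l (PadicAlgCl l)) V} (hL : IsStableLattice α L) (g : GL (Fin n) F)
    {v : V} (hv : v ∈ L) :
    ∃ f ∈ compactSections α ω L {vertexMk p n g}, f g = v := by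
  classical
  -- The formula uses an arbitrary decomposition `h = z k g`; `hf` removes the dependence on the
  -- choice.
  let f : GL (Fin n) F → V := fun h =>
    if hh : vertexMk p n h = vertexMk p n g then
      ((ω (vertexMk_eq_iff.1 hh).choose : integers l (PadicAlgCl l)) : PadicAlgCl l) •
        α (reduceGL p n F (vertexMk_eq_iff.1 hh).choose_spec.choose) v
    else 0
  have hf : ∀ (z : Fˣ) (k : GL (Fin n) (integers p F)),
      f (GeneralLinearGroup.scalar (Fin n) z * integralGL p n F k * g) =
        ((ω z : integers l (PadicAlgCl l)) : PadicAlgCl l) • α (reduceGL p n F k) v := by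
    intro z k
    have hh : vertexMk p n (GeneralLinearGroup.scalar (Fin n) z * integralGL p n F k * g) =
      vertexMk p n g := vertexMk_eq_iff.2 ⟨z, k, rfl⟩
    simp only [f, dif_pos hh]
    exact (reduceGL_smul_eq_of_mul_eq hn hω
      (mul_right_cancel (vertexMk_eq_iff.1 hh).choose_spec.choose_spec) v).symm
  have hf0 : ∀ h, vertexMk p n h ∉ ({vertexMk p n g} : Set (Vertex p n F)) → f h = 0 :=
    fun h hh => dif_neg hh
  refine ⟨f, ⟨⟨fun z k h => ?_, {vertexMk p n g}, Set.finite_singleton _, hf0⟩, fun h => ?_, hf0⟩, ?_⟩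
  · by_cases hh : vertexMk p n h = vertexMk p n g
    · obtain ⟨z', k', rfl⟩ := vertexMk_eq_iff.1 hh
      have h1 : GeneralLinearGroup.scalar (Fin n) z * integralGL p n F k *
          (GeneralLinearGroup.scalar (Fin n) z' * integralGL p n F k' * g) =
          GeneralLinearGroup.scalar (Fin n) (z * z') * integralGL p n F (k * k') * g := by
        have hc := GeneralLinearGroup.scalar_commute z' (integralGL p n F k)
        rw [map_mul, map_mul, mul_assoc, ← mul_assoc (integralGL p n F k),
          ← mul_assoc (integralGL p n F k), ← hc]
        simp only [mul_assoc]
      rw [h1, hf, hf, map_mul, map_mul, map_mul, Module.End.mul_apply, map_smul, smul_smul]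
      rfl
    · rw [hf0 h hh, map_zero, smul_zero]
      refine hf0 _ fun h2 => hh ?_
      rw [← Set.mem_singleton_iff.1 h2]
      exact (vertexMk_eq_iff.2 ⟨z, k, rfl⟩).symm
  · by_cases hh : vertexMk p n h = vertexMk p n g
    · obtain ⟨z', k', rfl⟩ := vertexMk_eq_iff.1 hh
      rw [hf]
      exact L.smul_mem _ (hL.stable _ _ hv)
    · rw [hf0 h hh]
      exact L.zero_mem
  · have := hf 1 1
    simpa using this

lemma twist_pow_apply (S : F →+* F) (i : ℕ) (f : GL (Fin n) F → V) (g : GL (Fin n) F) :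
    (twist l n V S ^ i) f g = f ((GeneralLinearGroup.map S)^[i] g) := by
  induction i generalizing f g with
  | zero => rfl
  | succ i ih =>
    rw [pow_succ, Module.End.mul_apply, ih, Function.iterate_succ_apply']
    rfl

end Sections

/-- A section over the vertex is determined by its value at `g`. For an invariant section that value
is fixed by `s`, the reduction of `k`, and the norm of `f'` takes the value `∑ α(s^i) f'(g)` at `g`.
Thus `IsCuspidal.exists_sum_pow_eq` provides `f'`, and equivariance extends the equality from `g` to
its coset. -/
lemma subsingleton_tateZero {p : ℕ} [Fact p.Prime] {l : ℕ} [Fact l.Prime] {n : ℕ} (hn : n ≠ 0)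
    (hpl : p ≠ l) {F : Type*} [Field F] [Algebra ℚ_[p] F] [FiniteDimensional ℚ_[p] F]
    {V : Type u} [AddCommGroup V] [Module (PadicAlgCl l) V]
    {α : Representation (PadicAlgCl l) (GL (Fin n) (Residue p F)) V} (hcusp : IsCuspidal α)
    {ω : Fˣ →* (integers l (PadicAlgCl l))ˣ} (hω : ExtendsCentralCharacter α ω)
    {L : Submodule (integers l (PadicAlgCl l)) V} (hL : IsStableLattice α L)
    {S : F →ₐ[ℚ_[p]] F} (hS : HasFixedResidues S) (hSl : ∀ x, S^[l] x = x)
    {u : (integers p F)ˣ} (hu : IsLocalRing.residue (integers p F) u ^ l = 1)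
    (hu1 : IsLocalRing.residue (integers p F) u ≠ 1)
    {g : GL (Fin n) F} {k : GL (Fin n) (integers p F)}
    (hg : GeneralLinearGroup.map (S : F →+* F) g = integralGL p n F k * g)
    (hk : ∀ c : Residue p F, c ^ l = 1 →
      (reduceGL p n F k : Matrix (Fin n) (Fin n) (Residue p F)) ≠ c • 1) :
    Subsingleton (TateZero α ω L (S : F →+* F) {vertexMk p n g}) := by
  have hfin := finite_residue p F
  rw [Submodule.Quotient.subsingleton_iff, Submodule.submoduleOf_eq_top]
  rintro f ⟨⟨⟨hf, -⟩, hfL, hf0⟩, hinv⟩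
  have hinv' : ∀ h, f (GeneralLinearGroup.map (S : F →+* F) h) = f h := fun h => by
    have : f - twist l n V (S : F →+* F) f = 0 := hinv
    exact (sub_eq_zero.1 (congrFun this h)).symm
  have hf1 : ∀ k : GL (Fin n) (integers p F),
      f (integralGL p n F k * g) = α (reduceGL p n F k) (f g) := fun k => by
    simpa using hf 1 k g
  have hdecomp : f g = 0 → f = 0 := fun h0 => funext fun h => by
    by_cases hh : vertexMk p n h = vertexMk p n g
    · obtain ⟨z, k₁, rfl⟩ := vertexMk_eq_iff.1 hh
      rw [hf, h0, map_zero, smul_zero]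
      rfl
    · exact hf0 h hh
  by_cases hfg0 : f g = 0
  · exact ⟨0, zero_mem _, (map_zero _).trans (hdecomp hfg0).symm⟩
  have hfg : α (reduceGL p n F k) (f g) = f g := by rw [← hf1, ← hg, hinv']
  -- Invariance of `f` at `z g` compares `ω(S z) f(g)` with `ω(z) f(g)`; the case `f(g) = 0` has
  -- been set aside so that `f(g)` can be cancelled.
  have hωS : ∀ z : Fˣ, ω (Units.map (S : F →* F) z) = ω z := fun z => by
    have h1 : f (GeneralLinearGroup.scalar (Fin n) z * integralGL p n F 1 * g) =
        ((ω z : integers l (PadicAlgCl l)) : PadicAlgCl l) • f g := by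
      rw [hf, map_one, map_one, Module.End.one_apply]
    have h2 : GeneralLinearGroup.map (S : F →+* F)
        (GeneralLinearGroup.scalar (Fin n) z * integralGL p n F 1 * g) =
        GeneralLinearGroup.scalar (Fin n) (Units.map (S : F →* F) z) * integralGL p n F k * g := by
      rw [map_one, mul_one, map_mul, GeneralLinearGroup.map_scalar, hg, mul_assoc]
      rfl
    rw [← hinv', h2, hf, hfg] at h1
    exact Units.ext (Subtype.ext (smul_left_injective _ hfg0 h1))
  obtain ⟨v', hv', hsum⟩ := hcusp.exists_sum_pow_eq Fact.out
    (natCast_residue_ne_zero Fact.out hpl) hu hu1 (hS.reduceGL_pow_eq_one hSl hg) hk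
    L.toAddSubgroup hL.stable (hfL g) hfg
  obtain ⟨f', hf', hf'g⟩ := exists_compactSections_singleton hn hω hL g hv'
  refine ⟨f', hf', ?_⟩
  obtain ⟨⟨hf'k, -⟩, -, hf'0⟩ := hf'
  have hiter : ∀ (i : ℕ) (z : Fˣ) (k₁ : GL (Fin n) (integers p F)),
      ∃ (z₁ : Fˣ) (k₂ : GL (Fin n) (integers p F)),
      (GeneralLinearGroup.map (S : F →+* F))^[i]
        (GeneralLinearGroup.scalar (Fin n) z * integralGL p n F k₁ * g) =
      GeneralLinearGroup.scalar (Fin n) z₁ * integralGL p n F k₂ *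
        (GeneralLinearGroup.map (S : F →+* F))^[i] g ∧
      ω z₁ = ω z ∧ reduceGL p n F k₂ = reduceGL p n F k₁ := by
    intro i z k₁
    induction i with
    | zero => exact ⟨z, k₁, rfl, rfl, rfl⟩
    | succ i ih =>
      obtain ⟨z₁, k₂, h1, h2, h3⟩ := ih
      refine ⟨Units.map (S : F →* F) z₁, GeneralLinearGroup.map (integersMap p S) k₂, ?_, ?_, ?_⟩
      · rw [Function.iterate_succ_apply', h1, map_mul, map_mul, map_integralGL,
          GeneralLinearGroup.map_scalar, ← Function.iterate_succ_apply' (GeneralLinearGroup.map _)]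
        rfl
      · rw [hωS, h2]
      · rw [hS.reduceGL_map, h3]
  funext h
  rw [LinearMap.sum_apply, Finset.sum_apply]
  simp only [twist_pow_apply]
  by_cases hh : vertexMk p n h = vertexMk p n g
  · obtain ⟨z, k₁, rfl⟩ := vertexMk_eq_iff.1 hh
    rw [hf, ← hsum, map_sum, Finset.smul_sum]
    refine Finset.sum_congr rfl fun i _ => ?_
    obtain ⟨z₁, k₂, h1, h2, h3⟩ := hiter i z k₁
    obtain ⟨k', h4, h5⟩ := hS.exists_iterate_map_eq hg i
    have h6 := hf'k 1 k' g
    rw [map_one, map_one, one_mul, hf'g, h5] at h6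
    rw [h1, hf'k, h2, h3, h4, h6]
    simp
  · rw [hf0 h hh]
    -- If `S^[i] h` lay over the vertex of `g`, applying `S^[l * i - i]` would return to `h` while
    -- keeping that vertex fixed.
    refine Finset.sum_eq_zero fun i _ => hf'0 _ fun hi => hh ?_
    have hper : ∀ x : GL (Fin n) F, (GeneralLinearGroup.map (S : F →+* F))^[l] x = x := fun x => by
      ext a b
      rw [iterate_map_apply, hSl]
    have hmap : ∀ x y : GL (Fin n) F, vertexMk p n x = vertexMk p n y → ∀ i,
        vertexMk p n ((GeneralLinearGroup.map (S : F →+* F))^[i] x) =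
          vertexMk p n ((GeneralLinearGroup.map (S : F →+* F))^[i] y) := fun x y hxy i => by
      induction i with
      | zero => exact hxy
      | succ i ih =>
        rw [Function.iterate_succ_apply', Function.iterate_succ_apply']
        exact congrArg (vertexMap p n S) ih
    have hgi : ∀ i, vertexMk p n ((GeneralLinearGroup.map (S : F →+* F))^[i] g) =
        vertexMk p n g := fun i => by
      obtain ⟨k', h4, -⟩ := hS.exists_iterate_map_eq hg i
      exact vertexMk_eq_iff.2 ⟨1, k', by rw [h4, map_one, one_mul]⟩
    have hil : i ≤ l * i := Nat.le_mul_of_pos_left i (Fact.out : l.Prime).pos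
    have h7 := hmap _ _ (Set.mem_singleton_iff.1 hi) (l * i - i)
    rw [← Function.iterate_add_apply, Nat.sub_add_cancel hil, hgi, Function.iterate_mul] at h7
    rwa [Function.iterate_fixed (hper h) i] at h7

end TateBuilding

/-! ### The dichotomy at a fixed vertex. -/

open TateBuilding in
theorem mainTheorem11 {p l : ℕ} [Fact p.Prime] [Fact l.Prime] (hpl : p ≠ l) (n : ℕ)
    {E F : Type*} [Field E] [Field F] [Algebra ℚ_[p] E] [Algebra ℚ_[p] F] [Algebra E F]
    [IsScalarTower ℚ_[p] E F] [FiniteDimensional ℚ_[p] E] [FiniteDimensional ℚ_[p] F]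
    [IsGalois E F] (hdeg : Module.finrank E F = l) (hram : IsTotallyRamified p E F)
    (σ : F ≃ₐ[E] F) (hσ : ∀ τ : F ≃ₐ[E] F, τ ∈ Subgroup.zpowers σ)
    {V : Type u} [AddCommGroup V] [Module (PadicAlgCl l) V] [FiniteDimensional (PadicAlgCl l) V]
    (α : Representation (PadicAlgCl l) (GL (Fin n) (Residue p F)) V)
    (hirr : α.IsIrreducible) (hcusp : IsCuspidal α)
    (ω : Fˣ →* (integers l (PadicAlgCl l))ˣ) (hω : ExtendsCentralCharacter α ω)
    (hgal : IsGaloisEquivariant E (levelZeroRep α ω))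
    (L : Submodule (integers l (PadicAlgCl l)) V) (hL : IsStableLattice α L) :
    tateSupport α ω L ((σ : F →ₐ[E] F).restrictScalars ℚ_[p]) ⊆
      Set.range (vertexEmbedding p n E F) := by
  rintro w ⟨hw, hnt⟩
  obtain ⟨g, rfl⟩ : ∃ g, vertexMk p n g = w := Quotient.exists_rep w
  rcases eq_or_ne n 0 with rfl | hn
  · exact vertexMk_mem_range_of_entries fun i => i.elim0
  have hl : l.Prime := Fact.out
  have : FiniteDimensional E F := Module.finite_of_finrank_pos (hdeg ▸ hl.pos)
  set S : F →ₐ[ℚ_[p]] F := (σ : F →ₐ[E] F).restrictScalars ℚ_[p] with hSdef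
  have hSσ : ∀ x, S x = σ x := fun _ => rfl
  -- Total ramification supplies residue representatives in `E`, which `σ` fixes.
  have hS : HasFixedResidues S := by
    intro x hx
    obtain ⟨a, ha⟩ := hram (IsLocalRing.residue (integers p F) ⟨x, mem_integers.2 hx⟩)
    have hres := residue_eq_iff (x := ⟨x, mem_integers.2 hx⟩)
      (y := integersMap p (IsScalarTower.toAlgHom ℚ_[p] E F) a)
    exact ⟨algebraMap E F a, σ.commutes _, hres.1 ha.symm⟩
  have hSl : ∀ x, S^[l] x = x := by
    have hpow : σ ^ l = 1 := by
      rw [← hdeg, ← IsGalois.card_aut_eq_finrank]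
      exact pow_card_eq_one'
    have hit : ∀ (i : ℕ) (x : F), S^[i] x = (σ ^ i) x := fun i x => by
      induction i with
      | zero => rfl
      | succ i ih => rw [Function.iterate_succ_apply', ih, pow_succ']; rfl
    intro x
    rw [hit, hpow]
    rfl
  have hfix : ∀ x, S x = x → x ∈ Set.range (algebraMap E F) := by
    intro x hx
    rw [IsGalois.mem_range_algebraMap_iff_fixed]
    intro τ
    have h1 : σ ∈ MulAction.stabilizer (F ≃ₐ[E] F) x := hx
    exact (Subgroup.zpowers_le.2 h1) (hσ τ)
  have hS1 : ∃ x, S x ≠ x := by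
    by_contra! hcon
    have h1 : σ = 1 := AlgEquiv.ext hcon
    have h2 : Nat.card (F ≃ₐ[E] F) = 1 := by
      rw [Nat.card_eq_one_iff_unique]
      refine ⟨⟨fun a b => ?_⟩, ⟨1⟩⟩
      have ha := hσ a
      have hb := hσ b
      rw [h1, Subgroup.zpowers_one_eq_bot, Subgroup.mem_bot] at ha hb
      rw [ha, hb]
    rw [IsGalois.card_aut_eq_finrank, hdeg] at h2
    exact hl.one_lt.ne' h2
  obtain ⟨ϖ, u, hϖ, hu, hu1⟩ := exists_uniformizer_map_eq_mul hl hpl hS hSl hS1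
  obtain ⟨k, hg⟩ := exists_map_eq_integralGL_mul hn hw
  by_cases hk : ∃ c : Residue p F, c ^ l = 1 ∧
      (reduceGL p n F k : Matrix (Fin n) (Fin n) (Residue p F)) = c • 1
  · obtain ⟨c, hc, hkc⟩ := hk
    exact hS.vertexMk_mem_range_of_reduceGL_scalar hl hpl hSl hfix hϖ hu hu1 hg hc hkc
  · push Not at hk
    exact absurd hnt (not_nontrivial_iff_subsingleton.2
      (subsingleton_tateZero hn hpl hcusp hω hL hS hSl hu hu1 hg hk))
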